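/- **Setting.** For $x\in\mathbb R^n$ let $s(x)=\{i: x_i\neq 0\}$ be its sparsity pattern and $k=|s(x)|$. One observes $Y=\mathbf A x+W\in\mathbb R^m$, where $W$ has i.i.d. standard Gaussian entries and $\mathbf A$ is a random $m\times n$ matrix, independent of $W$ (and chosen independently of $x$), with $\mathbb E\,\mathrm{tr}(\mathbf A\mathbf A^T)=m$. An estimator $\hat s(Y,\mathbf A,k)$ is a measurable function returning a set of $k$ indices; the distortion is $d(s,\hat s)=1-|s\cap\hat s|/|s|$. Let $\mathcal F_0$ be the set of distribution functions $F$ of real random variables $X$ with $\mathbb E X^2<\infty$ and $\Pr\{X=0\}=0$. For $0<\Omega\le 1/2$, the source $\mathcal X(\Omega,F)$ consists of all sequences $(x^n)_n$, $x^n\in\mathbb R^n$, such that $x^n$ has exactly $\lfloor \Omega n\rfloor$ nonzero elements and the empirical distribution functions of the nonzero elements of $x^n$ converge to $F$ uniformly on $\mathbb R$ as $n\to\infty$. Its power is $P(\Omega,F)=\Omega\,\mathbb E X^2$. For $P>0$, $\mathcal X(\Omega,F;P)$ is the source $\mathcal X(\Omega,F_a)$, where $F_a$ is the distribution function of $aX$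 and $a>0$ is chosen such that $P(\Omega,F_a)=P$. A pair $(\rho,\alpha)$ with $\rho\ge0$ is achievable for a source if for each $n$ there are an estimator and a random $\lceil\rho n\rceil\times n$ sampling matrix as above such that, for every sequence $(x^n)$ of the source, $\Pr\{d(s(x^n),\hat s(Y,\mathbf A,k))>\alpha\}\to0$ as $n\to\infty$. The sampling rate distortion function $\rho(\alpha)\in[0,\infty]$ is the infimum of the $\rho\ge 0$ such that $(\rho,\alpha)$ is achievable. $F$ has decay rate $L$ if $L=\lim_{\epsilon\downarrow0}\log\epsilon\,/\log\big(F(\epsilon)-F(-\epsilon)\big)$ (the quotient is read as $0$ where $F(\epsilon)=F(-\epsilon)$). **Proposition 7.** Let $F\in\mathcal F_0$ have decay rate $L\in[0,\infty)$, and suppose that the quantiles $x_\epsilon=\inf\{x\ge0:\Pr\{|X|\le x\}\ge\epsilon\}$ satisfy $x_\epsilon=O(\epsilon^{L})$ as $\epsilon\downarrow0$ (in particular, this holds if $\epsilon^{-L}x_\epsilon$ converges to a finite limit). Then there is a constant $C_F>0$, depending only on $F$, such that for all $\Omega\in(0,1/2]$, all $P>0$ and all $\alpha\in(0,1/4)$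 the sampling rate distortion function $\rho(\alpha)$ of the source $\mathcal X(\Omega,F;P)$ satisfies $$\rho(\alpha)\;\ge\; C_F\cdot\frac{\alpha\Omega\,\log\big(\frac1{\alpha\Omega}\big)}{\log\big(1+\alpha^{2L+1}P\big)} .$$ -/

import Mathlib

open MeasureTheory ProbabilityTheory Filter Topology
open scoped ENNReal NNReal Matrix

namespace SparsityPattern

noncomputable section

/-! ### Distributions on the real line

A distribution `F` is given by the probability measure `μ` it is the cumulative distribution
function of, `F = cdf μ`. -/

/-- The class of distributions of random variables `X` with `E X ^ 2 < ∞` and `Pr {X = 0} = 0`. -/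
structure IsAdmissible (μ : Measure ℝ) : Prop where
  isProbabilityMeasure : IsProbabilityMeasure μ
  memLp_two : MemLp (fun x : ℝ => x) 2 μ
  no_atom_zero : μ {0} = 0

/-- The power `Ω (mean ^ 2 + variance)` of the source with sparsity rate `Ω` and distribution
`μ`. -/
def power (Ω : ℝ) (μ : Measure ℝ) : ℝ :=
  Ω * ((∫ x, x ∂μ) ^ 2 + Var[fun x : ℝ => x; μ])

/-- The law of `a X`, `X` of law `μ`, with the factor `a > 0` for which the source with sparsity
rate `Ω` has power `P`. -/
def rescale (Ω P : ℝ) (μ : Measure ℝ) : Measure ℝ :=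
  μ.map (fun x : ℝ => √(P / power Ω μ) * x)

/-- `L` is the decay rate of `μ`: the limit of `log ε / log (F ε - F (-ε))` as `ε ↓ 0` exists and
equals `L`. If `F ε - F (-ε) = 0`, then the quotient is `0` (the usual reading of
`log ε / (-∞)`, which is also its value in Lean). -/
def HasDecayRate (μ : Measure ℝ) (L : ℝ) : Prop :=
  Tendsto (fun ε : ℝ => Real.log ε / Real.log (cdf μ ε - cdf μ (-ε))) (𝓝[>] 0) (𝓝 L)

/-- The quantile `x_ε = inf {x ≥ 0 : Pr {|X| ≤ x} ≥ ε}` of `|X|`, `X` of law `μ`. -/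
def absQuantile (μ : Measure ℝ) (ε : ℝ) : ℝ :=
  sInf {x : ℝ | 0 ≤ x ∧ ε ≤ μ.real {y : ℝ | |y| ≤ x}}

/-! ### Sparsity patterns and vector sources -/

/-- The sparsity pattern of a vector: the set of indices of its nonzero elements. -/
def pattern {n : ℕ} (x : Fin n → ℝ) : Finset (Fin n) :=
  {i | x i ≠ 0}

/-- The distortion `1 - |s ∩ t| / |s|` between a pattern `s` and an estimate `t`. -/
def distortion {n : ℕ} (s t : Finset (Fin n)) : ℝ :=
  1 - ((s ∩ t).card : ℝ) / (s.card : ℝ)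

/-- The empirical distribution function of the nonzero elements of a vector. -/
def empiricalCDF {n : ℕ} (x : Fin n → ℝ) (t : ℝ) : ℝ :=
  (1 / ((pattern x).card : ℝ)) * ∑ i ∈ pattern x, if x i ≤ t then (1 : ℝ) else 0

/-- A vector source: a set of sequences of vectors, the `n`-th one in `ℝ ^ n`. -/
abbrev VectorSource : Type := Set ((n : ℕ) → Fin n → ℝ)

/-- The source with sparsity rate `Ω` and distribution `μ`: all sequences whose `n`-th vector has
exactly `⌊Ω n⌋` nonzero elements, and for which the empirical distribution functions of the nonzero
elements converge uniformly to the distribution function of `μ`. -/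
def source (Ω : ℝ) (μ : Measure ℝ) : VectorSource :=
  {x | (∀ n : ℕ, (pattern (x n)).card = ⌊Ω * (n : ℝ)⌋₊) ∧
    TendstoUniformly (fun n : ℕ => empiricalCDF (x n)) (cdf μ) atTop}

/-! ### Sampling, estimation, achievability -/

/-- Matrices carry the product (Borel) σ-algebra of their entries. -/
instance instMeasurableSpaceMatrix (m n : ℕ) : MeasurableSpace (Matrix (Fin m) (Fin n) ℝ) :=
  inferInstanceAs (MeasurableSpace (Fin m → Fin n → ℝ))

/-- The law of the noise: `m` independent standard Gaussian random variables. -/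
def noise (m : ℕ) : Measure (Fin m → ℝ) :=
  Measure.pi fun _ => gaussianReal 0 1

/-- Laws of random `m × n` sampling matrices, with the normalization `E tr (A Aᵀ) = m`. -/
structure IsSamplingLaw {m n : ℕ} (Q : Measure (Matrix (Fin m) (Fin n) ℝ)) : Prop where
  isProbabilityMeasure : IsProbabilityMeasure Q
  integrable_trace : Integrable (fun A : Matrix (Fin m) (Fin n) ℝ => (A * Aᵀ).trace) Q
  integral_trace : ∫ A, (A * Aᵀ).trace ∂Q = (m : ℝ)

/-- A sparsity pattern estimator `ŝ (y, A, k)`: a measurable function of the samples `y` and the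
sampling matrix `A` that, told the sparsity `k`, returns a set of `k` indices. -/
structure Estimator (m n : ℕ) where
  toFun : (Fin m → ℝ) → Matrix (Fin m) (Fin n) ℝ → ℕ → Finset (Fin n)
  card_eq : ∀ y A k, k ≤ n → (toFun y A k).card = k
  measurableSet_fiber : ∀ k s,
    MeasurableSet {p : (Fin m → ℝ) × Matrix (Fin m) (Fin n) ℝ | toFun p.1 p.2 k = s}

/-- The probability, over the independent random matrix `A` of law `Q` and noise `W`, that the
estimate of the pattern of `x` from the samples `A x + W` has distortion larger than `α`. -/
def errorProb {m n : ℕ} (Q : Measure (Matrix (Fin m) (Fin n) ℝ)) (S : Estimator m n) (α : ℝ)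
    (x : Fin n → ℝ) : ℝ≥0∞ :=
  (Q.prod (noise m)) {p : Matrix (Fin m) (Fin n) ℝ × (Fin m → ℝ) |
    α < distortion (pattern x) (S.toFun (p.1 *ᵥ x + p.2) p.1 (pattern x).card)}

/-- The pair `(ρ, α)` is achievable for the source `X`: there are, for each `n`, a random
`⌈ρ n⌉ × n` sampling matrix and an estimator, such that the probability of error tends to `0` along
every sequence of the source. (If the source consists of all sequences `x` with `x n` in a given
set `X n`, this says that the supremum over `X n` of the probability of error tends to `0`.) -/
def Achievable (X : VectorSource) (ρ : ℝ≥0) (α : ℝ) : Prop :=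
  ∃ (Q : (n : ℕ) → Measure (Matrix (Fin ⌈ρ * (n : ℝ≥0)⌉₊) (Fin n) ℝ))
    (S : (n : ℕ) → Estimator ⌈ρ * (n : ℝ≥0)⌉₊ n),
    (∀ n, IsSamplingLaw (Q n)) ∧
    ∀ x ∈ X, Tendsto (fun n : ℕ => errorProb (Q n) (S n) α (x n)) atTop (𝓝 0)

/-- The sampling rate distortion function: the infimum of the rates `ρ ≥ 0` for which `(ρ, α)` is
achievable (`∞` if there is none). -/
def rateDistortion (X : VectorSource) (α : ℝ) : ℝ≥0∞ :=
  ⨅ (ρ : ℝ≥0) (_ : Achievable X ρ α), (ρ : ℝ≥0∞)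

end

end SparsityPattern

/-! The bound is a Fano-type converse in which the positions of all but a few small nonzero elements
are treated as known. Let `k` be the sparsity. For large `n`, more than a proportion `2α` of the
nonzero elements are below a threshold slightly exceeding the `3α`-quantile of the magnitudes. Keep
the other elements fixed and let `b ≈ 2αk` small ones move, each freely within its own block of `B ≈
1 / (2αΩ)` positions, up to a factor `1 - Ω`. All `B ^ b` vectors obtained have the same empirical
distribution, so a successful scheme must eventually recover each of them with probability at least
`1 / 2` (`exists_blockVec`, `eventually_errorProb_le`).

Distortion at most `α` allows about `b / 2` misses, so an estimate must locate about half of the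
moving elements. By a Chernoff bound, any fixed index set does this for at most a fraction `exp
(-γ)` of the vectors, with `γ ≈ (b / 2) log B` to leading order for large `B`
(`card_distortion_le`).

For a fixed matrix `A`, compare the law of the samples with a Gaussian law of covariance `(1 + λ) I`
centred at the average of `A x`. This reference carries no information about the positions, so
success under it has average probability at most `exp (-γ)`. A change of measure
(`mul_noise_real_le`) bounds `γ` times the success probability by the divergence plus a constant.
The blocks are disjoint and an element of size `τ` spread over `B` positions has mean square `τ² / B
≤ λ` per position, so the averaged divergence is at most `(m / 2) log (1 + λ)` (`half_exponent_le`).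

Letting `n → ∞` gives `αΩ (log (B / 2) - 1 + 2 / B) ≤ ρ log (1 + λ)`. The quantile bound makes the
squared threshold of order `α ^ (2L) P / Ω`; division by `B` permits `λ` to be a constant times `α ^
(2L + 1) P`. -/

namespace SparsityPattern

/-! ### Change of measure for the Gaussian channel -/

/-- A product of measures with densities has the product density. -/
lemma pi_withDensity {ι : Type*} [Fintype ι] (ν : ι → Measure ℝ)
    [∀ i, IsProbabilityMeasure (ν i)] (f : ι → ℝ → ℝ≥0∞) (hf : ∀ i, Measurable (f i))
    [∀ i, SigmaFinite ((ν i).withDensity (f i))] :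
    Measure.pi (fun i => (ν i).withDensity (f i)) =
      (Measure.pi ν).withDensity (fun x => ∏ i, f i (x i)) := by
  refine Measure.pi_eq fun s hs => ?_
  rw [withDensity_apply _ (MeasurableSet.univ_pi hs)]
  have hind : ∀ x : ι → ℝ, (Set.univ.pi s).indicator (fun x => ∏ i, f i (x i)) x
      = ∏ i, (s i).indicator (f i) (x i) := by
    intro x
    by_cases hx : x ∈ Set.univ.pi s
    · rw [Set.indicator_of_mem hx]
      exact Finset.prod_congr rfl fun i _ => (Set.indicator_of_mem (hx i trivial) _).symm
    · rw [Set.indicator_of_notMem hx]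
      simp only [Set.mem_pi, Set.mem_univ, true_imp_iff, not_forall] at hx
      obtain ⟨i, hi⟩ := hx
      exact (Finset.prod_eq_zero (Finset.mem_univ i) (Set.indicator_of_notMem hi _)).symm
  rw [← lintegral_indicator (MeasurableSet.univ_pi hs)]
  simp_rw [hind]
  rw [lintegral_prod_eq_prod_lintegral_of_indepFun Finset.univ
    (fun i (x : ι → ℝ) => (s i).indicator (f i) (x i))
    (iIndepFun_pi fun i => ((hf i).indicator (hs i)).aemeasurable)
    (fun i => ((hf i).indicator (hs i)).comp (measurable_pi_apply i))]
  refine Finset.prod_congr rfl fun i _ => ?_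
  rw [withDensity_apply _ (hs i), ← lintegral_indicator (hs i)]
  exact (measurePreserving_eval ν i).lintegral_comp ((hf i).indicator (hs i))

/-- The log-likelihood ratio, at the noise value `w`, of `N(0, 1)` and `N(-c, s)`. -/
noncomputable def llr (s c w : ℝ) : ℝ :=
  Real.log s / 2 - w ^ 2 / 2 + (c + w) ^ 2 / (2 * s)

lemma measurable_llr (s c : ℝ) : Measurable (llr s c) := by
  unfold llr; fun_prop

lemma measurable_exp_neg_llr (s c : ℝ) :
    Measurable (fun w => ENNReal.ofReal (Real.exp (-llr s c w))) :=
  (measurable_llr s c).neg.exp.ennreal_ofReal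

lemma gaussianReal_neg_eq_withDensity (s : ℝ≥0) (hs : 0 < s) (c : ℝ) :
    gaussianReal (-c) s =
      (gaussianReal 0 1).withDensity (fun w => ENNReal.ofReal (Real.exp (-llr s c w))) := by
  rw [gaussianReal_of_var_ne_zero _ hs.ne', gaussianReal_of_var_ne_zero _ one_ne_zero,
    ← withDensity_mul _ (measurable_gaussianPDF _ _) (measurable_exp_neg_llr s c)]
  congr 1
  ext w
  have hs' : (0 : ℝ) < s := hs
  rw [Pi.mul_apply, gaussianPDF, gaussianPDF,
    ← ENNReal.ofReal_mul (gaussianPDFReal_nonneg _ _ _)]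
  congr 1
  simp only [gaussianPDFReal, llr]
  have h1 : Real.exp (-(Real.log s / 2 - w ^ 2 / 2 + (c + w) ^ 2 / (2 * s)))
      = (√(s : ℝ))⁻¹ * Real.exp (w ^ 2 / 2 - (c + w) ^ 2 / (2 * s)) := by
    rw [show (√(s : ℝ))⁻¹ = Real.exp (-(Real.log s / 2)) by
      rw [Real.exp_neg, Real.exp_half, Real.exp_log hs'], ← Real.exp_add]
    ring_nf
  rw [h1, Real.sqrt_mul (by positivity), NNReal.coe_one, mul_one, mul_inv]
  rw [show (√(2 * Real.pi))⁻¹ * Real.exp (-(w - 0) ^ 2 / (2 * 1)) *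
      ((√(s : ℝ))⁻¹ * Real.exp (w ^ 2 / 2 - (c + w) ^ 2 / (2 * s)))
      = (√(2 * Real.pi))⁻¹ * (√(s : ℝ))⁻¹ * (Real.exp (-(w - 0) ^ 2 / (2 * 1)) *
        Real.exp (w ^ 2 / 2 - (c + w) ^ 2 / (2 * s))) by ring, ← Real.exp_add]
  congr 2
  ring

instance (m : ℕ) : IsProbabilityMeasure (noise m) := by unfold noise; infer_instance

/-- The law of `m` independent centred Gaussian random variables of variance `s`. -/
noncomputable def gaussianRef (m : ℕ) (s : ℝ≥0) : Measure (Fin m → ℝ) :=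
  Measure.pi fun _ => gaussianReal 0 s

instance (m : ℕ) (s : ℝ≥0) : IsProbabilityMeasure (gaussianRef m s) := by
  unfold gaussianRef; infer_instance

/-- Reweighting the noise by the likelihood ratio turns coordinate `i` into `N(-d i, s)`, and the
shift by `d` recentres it. Thus reference probabilities become integrals of `exp (-ℓ)` against the
noise. -/
lemma gaussianRef_eq_map {m : ℕ} (s : ℝ≥0) (hs : 0 < s) (d : Fin m → ℝ) :
    gaussianRef m s = ((noise m).withDensity
      (fun w => ENNReal.ofReal (Real.exp (-∑ i, llr s (d i) (w i))))).map (fun w => d + w) := by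
  have h1 : (noise m).withDensity
      (fun w => ENNReal.ofReal (Real.exp (-∑ i, llr s (d i) (w i))))
      = Measure.pi fun i => gaussianReal (-(d i)) s := by
    have hden : ∀ i, (gaussianReal 0 1).withDensity
        (fun w => ENNReal.ofReal (Real.exp (-llr s (d i) w))) = gaussianReal (-(d i)) s :=
      fun i => (gaussianReal_neg_eq_withDensity s hs (d i)).symm
    have : ∀ i, SigmaFinite ((gaussianReal 0 1).withDensity
        (fun w => ENNReal.ofReal (Real.exp (-llr s (d i) w)))) := by
      intro i; rw [hden]; infer_instance
    have h2 := pi_withDensity (fun _ : Fin m => gaussianReal 0 1)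
      (fun i w => ENNReal.ofReal (Real.exp (-llr s (d i) w)))
      (fun i => measurable_exp_neg_llr s (d i))
    rw [funext hden] at h2
    rw [h2, noise]
    congr 1
    ext w
    rw [← ENNReal.ofReal_prod_of_nonneg (fun i _ => (Real.exp_pos _).le), ← Real.exp_sum,
      Finset.sum_neg_distrib]
  rw [h1, gaussianRef]
  have h3 := Measure.pi_map_pi (μ := fun i => gaussianReal (-(d i)) s)
    (f := fun i (x : ℝ) => d i + x) (fun i => by fun_prop)
  simp_rw [gaussianReal_map_const_add, neg_add_cancel] at h3
  rw [← h3]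
  rfl

lemma integrable_llr (s c : ℝ) : Integrable (llr s c) (gaussianReal 0 1) := by
  have h2 : Integrable (fun w : ℝ => w ^ 2) (gaussianReal 0 1) :=
    (memLp_id_gaussianReal (μ := 0) (v := 1) 2).integrable_sq
  have h1 : Integrable (fun w : ℝ => w) (gaussianReal 0 1) :=
    (memLp_id_gaussianReal (μ := 0) (v := 1) 2).integrable (by norm_num)
  have : llr s c = fun w => (Real.log s / 2 + c ^ 2 / (2 * s)) + ((1 / (2 * s) - 1 / 2) * w ^ 2
      + (c / s) * w) := by
    ext w; unfold llr; ring
  rw [this]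
  exact (integrable_const _).add ((h2.const_mul _).add (h1.const_mul _))

lemma integral_llr (s c : ℝ) : ∫ w, llr s c w ∂(gaussianReal 0 1)
    = Real.log s / 2 - 1 / 2 + (1 + c ^ 2) / (2 * s) := by
  have h2 : Integrable (fun w : ℝ => w ^ 2) (gaussianReal 0 1) :=
    (memLp_id_gaussianReal (μ := 0) (v := 1) 2).integrable_sq
  have h1 : Integrable (fun w : ℝ => w) (gaussianReal 0 1) :=
    (memLp_id_gaussianReal (μ := 0) (v := 1) 2).integrable (by norm_num)
  have hv : ∫ w, w ^ 2 ∂(gaussianReal 0 1) = 1 := by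
    have := variance_fun_id_gaussianReal (μ := 0) (v := 1)
    rw [variance_of_integral_eq_zero (by fun_prop) integral_id_gaussianReal] at this
    simpa using this
  have : llr s c = fun w => (Real.log s / 2 + c ^ 2 / (2 * s)) + ((1 / (2 * s) - 1 / 2) * w ^ 2
      + (c / s) * w) := by
    ext w; unfold llr; ring
  have h3 : Integrable (fun w : ℝ => (1 / (2 * s) - 1 / 2) * w ^ 2 + (c / s) * w)
      (gaussianReal 0 1) := (h2.const_mul _).add (h1.const_mul _)
  simp only [this]
  rw [integral_add (integrable_const _) h3, integral_add (h2.const_mul _) (h1.const_mul _), integral_const_mul, integral_const_mul, hv,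
    integral_id_gaussianReal]
  simp
  ring

/-- Change of measure for the Gaussian channel: an event that is likely under the channel law with
mean `d` but unlikely under the reference law forces the divergence of the two laws to be large. -/
theorem mul_noise_real_le {m : ℕ} (s : ℝ≥0) (hs : 0 < s) (d : Fin m → ℝ) (γ : ℝ)
    (E : Set (Fin m → ℝ)) (hE : MeasurableSet E) :
    γ * (noise m).real {w | d + w ∈ E} ≤
      m * (Real.log s / 2 - 1 / 2 + 1 / (2 * s)) + (∑ i, d i ^ 2) / (2 * s)
        + Real.exp γ * (gaussianRef m s).real E := by
  set E' : Set (Fin m → ℝ) := {w | d + w ∈ E} with hE'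
  have hmE' : MeasurableSet E' := (measurable_const_add d) hE
  set ℓ : (Fin m → ℝ) → ℝ := fun w => ∑ i, llr s (d i) (w i) with hℓ
  have hmℓ : Measurable ℓ := Finset.measurable_sum _ fun i _ =>
    (measurable_llr s (d i)).comp (measurable_pi_apply i)
  have hcoord : ∀ i, Integrable (fun w : Fin m → ℝ => llr s (d i) (w i)) (noise m) := fun i =>
    (measurePreserving_eval (fun _ : Fin m => gaussianReal 0 1) i).integrable_comp_of_integrable
      (integrable_llr s (d i))
  have hℓi : Integrable ℓ (noise m) := integrable_finsetSum _ fun i _ => hcoord i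
  have hℓint : ∫ w, ℓ w ∂(noise m) =
      m * (Real.log s / 2 - 1 / 2 + 1 / (2 * s)) + (∑ i, d i ^ 2) / (2 * s) := by
    rw [hℓ, integral_finsetSum _ fun i _ => hcoord i]
    have : ∀ i, ∫ w, llr s (d i) (w i) ∂(noise m) =
        Real.log s / 2 - 1 / 2 + 1 / (2 * s) + d i ^ 2 / (2 * s) := by
      intro i
      rw [noise, integral_comp_eval (μ := fun _ : Fin m => gaussianReal 0 1) (f := llr s (d i))
        (measurable_llr s (d i)).aestronglyMeasurable, integral_llr]
      ring
    simp_rw [this]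
    rw [Finset.sum_add_distrib, Finset.sum_div]
    simp [mul_add]
  have hR : ∀ F : Set (Fin m → ℝ), MeasurableSet F → gaussianRef m s F =
      ∫⁻ w in {w | d + w ∈ F}, ENNReal.ofReal (Real.exp (-ℓ w)) ∂(noise m) := by
    intro F hF
    rw [gaussianRef_eq_map s hs d, Measure.map_apply (measurable_const_add d) hF,
      withDensity_apply _ ((measurable_const_add d) hF)]
    rfl
  have hme : Measurable (fun w => Real.exp (-ℓ w)) := hmℓ.neg.exp
  have hexpi : Integrable (fun w => Real.exp (-ℓ w)) (noise m) := by
    refine ⟨hme.aestronglyMeasurable, ?_⟩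
    rw [hasFiniteIntegral_iff_ofReal (ae_of_all _ fun w => (Real.exp_pos _).le)]
    have := hR Set.univ MeasurableSet.univ
    simp only [Set.mem_univ, Set.ofPred_true, setLIntegral_univ] at this
    rw [← this]
    exact measure_lt_top _ _
  have hexp : ∀ F : Set (Fin m → ℝ), MeasurableSet F → (gaussianRef m s).real F =
      ∫ w in {w | d + w ∈ F}, Real.exp (-ℓ w) ∂(noise m) := by
    intro F hF
    rw [integral_eq_lintegral_of_nonneg_ae (ae_of_all _ fun w => (Real.exp_pos _).le)
      hme.aestronglyMeasurable, ← hR F hF]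
    rfl
  have hone : ∫ w, Real.exp (-ℓ w) ∂(noise m) = 1 := by
    have := hexp Set.univ MeasurableSet.univ
    simpa using this.symm
  have hadd : Integrable (fun w => Real.exp (-ℓ w) +
      Real.exp γ * E'.indicator (fun w => Real.exp (-ℓ w)) w) (noise m) :=
    hexpi.add ((hexpi.indicator hmE').const_mul _)
  -- Pointwise this is `1 + v ≤ exp v`, with `v = γ - ℓ` on the event and `v = -ℓ` off it. The terms
  -- `exp (-ℓ)` and `1` cancel after integration.
  have key : ∫ w, (E'.indicator (fun _ => γ) w - ℓ w) ∂(noise m) ≤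
      ∫ w, (Real.exp (-ℓ w) + Real.exp γ * E'.indicator (fun w => Real.exp (-ℓ w)) w - 1)
        ∂(noise m) := by
    refine integral_mono (((integrable_const _).indicator hmE').sub hℓi)
      (hadd.sub (integrable_const _)) fun w => ?_
    by_cases hw : w ∈ E'
    · simp only [Set.indicator_of_mem hw]
      have := Real.add_one_le_exp (γ - ℓ w)
      rw [sub_eq_add_neg γ, Real.exp_add] at this
      have := Real.exp_pos (-ℓ w)
      linarith
    · simp only [Set.indicator_of_notMem hw]
      have := Real.add_one_le_exp (-ℓ w)
      linarith
  rw [integral_sub ((integrable_const _).indicator hmE') hℓi,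
    integral_sub hadd (integrable_const _),
    integral_add hexpi ((hexpi.indicator hmE').const_mul _), hone, integral_const_mul,
    integral_indicator hmE', integral_indicator hmE', ← hexp E hE, hℓint] at key
  simp only [integral_const, smul_eq_mul, mul_one, measureReal_restrict_apply_univ, probReal_univ] at key
  linarith

/-! ### Second moments and Chernoff bounds on a finite product space -/

section ProductCounting

variable {ι κ : Type*} [Fintype ι] [DecidableEq ι] [Fintype κ]

lemma sum_pi_prod (g : ι → κ → ℝ) : ∑ S : ι → κ, ∏ i, g i (S i) = ∏ i, ∑ l, g i l := by
  rw [Finset.prod_univ_sum, Fintype.piFinset_univ]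

lemma card_mul_sum_pi_eval (i : ι) (g : κ → ℝ) :
    (Fintype.card κ : ℝ) * ∑ S : ι → κ, g (S i) =
      (Fintype.card κ : ℝ) ^ Fintype.card ι * ∑ l, g l := by
  have h := sum_pi_prod (fun t l => if t = i then g l else (1 : ℝ))
  have h1 : ∀ S : ι → κ, ∏ t, (if t = i then g (S t) else (1 : ℝ)) = g (S i) := by
    intro S
    rw [Finset.prod_ite_eq' Finset.univ i (fun t => g (S t)), if_pos (Finset.mem_univ i)]
  simp_rw [h1] at h
  rw [h, ← Finset.mul_prod_erase _ _ (Finset.mem_univ i)]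
  have h2 : ∏ t ∈ Finset.univ.erase i, ∑ l : κ, (if t = i then g l else (1 : ℝ))
      = ∏ t ∈ (Finset.univ : Finset ι).erase i, (Fintype.card κ : ℝ) := by
    refine Finset.prod_congr rfl fun t ht => ?_
    simp [Finset.ne_of_mem_erase ht]
  have h3 : (Fintype.card κ : ℝ) * ∏ t ∈ (Finset.univ : Finset ι).erase i, (Fintype.card κ : ℝ)
      = (Fintype.card κ : ℝ) ^ Fintype.card ι := by
    rw [Finset.mul_prod_erase _ (fun _ => (Fintype.card κ : ℝ)) (Finset.mem_univ i)]
    simp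
  rw [h2, ← h3]
  simp only [if_true]
  ring

/-- Distinct coordinates of a uniform `S` are independent, so centring one factor suffices to make
the correlation vanish. -/
lemma sum_pi_mul_eval {i j : ι} (hij : i ≠ j) (f g : κ → ℝ) (hf : ∑ l, f l = 0) :
    ∑ S : ι → κ, f (S i) * g (S j) = 0 := by
  have h := sum_pi_prod (fun t l => (if t = i then f l else (1 : ℝ)) *
    (if t = j then g l else (1 : ℝ)))
  simp_rw [Finset.prod_mul_distrib] at h
  have h1 : ∀ (S : ι → κ) (k : ι) (f : κ → ℝ),
      ∏ t, (if t = k then f (S t) else (1 : ℝ)) = f (S k) := by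
    intro S k f
    rw [Finset.prod_ite_eq' Finset.univ k (fun t => f (S t)), if_pos (Finset.mem_univ k)]
  simp_rw [h1] at h
  rw [h]
  refine Finset.prod_eq_zero (Finset.mem_univ i) ?_
  simp [hij, hf]

/-- The variance of a sum of independent terms is at most the sum of the second moments; here the
terms are functions of independent uniformly distributed elements of `κ`. -/
theorem sum_pi_sq_sum_sub_mean_le [Nonempty κ] (r : ι → κ → ℝ) :
    ∑ S : ι → κ, (∑ j, (r j (S j) - (∑ l, r j l) / Fintype.card κ)) ^ 2 ≤
      (Fintype.card κ : ℝ) ^ Fintype.card ι * ∑ j, (∑ l, r j l ^ 2) / Fintype.card κ := by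
  have hc : (0 : ℝ) < Fintype.card κ := by exact_mod_cast Fintype.card_pos
  set f : ι → κ → ℝ := fun j l => r j l - (∑ l, r j l) / Fintype.card κ with hf
  have hf0 : ∀ j, ∑ l, f j l = 0 := by
    intro j
    simp only [hf, Finset.sum_sub_distrib, Finset.sum_const, Finset.card_univ, nsmul_eq_mul]
    field_simp
    ring
  have hf2 : ∀ j, ∑ l, f j l ^ 2 ≤ ∑ l, r j l ^ 2 := by
    intro j
    have : ∑ l, r j l ^ 2 = ∑ l, f j l ^ 2 + Fintype.card κ * ((∑ l, r j l) / Fintype.card κ) ^ 2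
        := by
      have h : ∀ l, r j l ^ 2 = f j l ^ 2 + 2 * ((∑ l, r j l) / Fintype.card κ) * f j l
          + ((∑ l, r j l) / Fintype.card κ) ^ 2 := by
        intro l; simp only [hf]; ring
      rw [Finset.sum_congr rfl fun l _ => h l, Finset.sum_add_distrib, Finset.sum_add_distrib,
        ← Finset.mul_sum, hf0]
      simp
    rw [this]
    have : 0 ≤ (Fintype.card κ : ℝ) * ((∑ l, r j l) / Fintype.card κ) ^ 2 := by positivity
    linarith
  calc ∑ S : ι → κ, (∑ j, f j (S j)) ^ 2
      = ∑ j, ∑ S : ι → κ, f j (S j) ^ 2 := by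
        simp_rw [sq, Finset.sum_mul_sum]
        rw [Finset.sum_comm]
        refine Finset.sum_congr rfl fun i _ => ?_
        rw [Finset.sum_comm]
        refine Finset.sum_eq_single i (fun j _ hij => ?_) (by simp)
        exact sum_pi_mul_eval hij.symm (f i) (f j) (hf0 i)
    _ = ∑ j, (Fintype.card κ : ℝ) ^ Fintype.card ι * ((∑ l, f j l ^ 2) / Fintype.card κ) := by
        refine Finset.sum_congr rfl fun j _ => ?_
        have := card_mul_sum_pi_eval j (fun l => f j l ^ 2)
        rw [← mul_div_assoc, eq_div_iff hc.ne', ← this]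
        ring
    _ ≤ _ := by
        rw [← Finset.mul_sum]
        exact mul_le_mul_of_nonneg_left (Finset.sum_le_sum fun j _ =>
          div_le_div_of_nonneg_right (hf2 j) hc.le) (by positivity)

/-- Chernoff bound for the number of coordinates `j` of a uniformly distributed `S : ι → κ` with
`p j (S j)`. -/
theorem card_hits_le [Nonempty κ] (p : ι → κ → Prop) [∀ j l, Decidable (p j l)] (u h : ℝ)
    (hu : 1 ≤ u) :
    (Finset.card {S : ι → κ | h ≤ (Finset.card {j | p j (S j)} : ℝ)} : ℝ) ≤
      (Fintype.card κ : ℝ) ^ Fintype.card ι *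
        Real.exp ((u - 1) * (∑ j, (Finset.card {l | p j l} : ℝ)) / Fintype.card κ
          - h * Real.log u) := by
  have hc : (0 : ℝ) < Fintype.card κ := by exact_mod_cast Fintype.card_pos
  have hu0 : 0 < u := by linarith
  have hgen := sum_pi_prod (fun j l => if p j l then u else (1 : ℝ))
  have h1 : ∀ S : ι → κ, ∏ j, (if p j (S j) then u else (1 : ℝ))
      = Real.exp ((Finset.card {j | p j (S j)} : ℝ) * Real.log u) := by
    intro S
    rw [Finset.prod_ite, Finset.prod_const, Finset.prod_const_one, mul_one, mul_comm,
      ← Real.rpow_def_of_pos hu0, Real.rpow_natCast]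
  -- Giving each hit weight `u`, the generating function of one coordinate is `1 + (u - 1) p`, with
  -- `p` its hit probability, and this is at most `exp ((u - 1) p)`.
  have h2 : ∀ j, ∑ l, (if p j l then u else (1 : ℝ)) ≤
      Fintype.card κ * Real.exp ((u - 1) * (Finset.card {l | p j l} : ℝ) / Fintype.card κ) := by
    intro j
    have : ∑ l, (if p j l then u else (1 : ℝ)) =
        Fintype.card κ * ((u - 1) * (Finset.card {l | p j l} : ℝ) / Fintype.card κ + 1) := by
      have h : ∀ l, (if p j l then u else (1 : ℝ)) = (if p j l then (u - 1) else 0) + 1 := by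
        intro l; split_ifs <;> ring
      rw [Finset.sum_congr rfl fun l _ => h l, Finset.sum_add_distrib, ← Finset.sum_filter]
      simp only [Finset.sum_const, nsmul_eq_mul, Finset.card_univ, mul_one]
      field_simp
    rw [this]
    gcongr
    exact Real.add_one_le_exp _
  have h3 : (Finset.card {S : ι → κ | h ≤ (Finset.card {j | p j (S j)} : ℝ)} : ℝ) *
      Real.exp (h * Real.log u) ≤
        ∑ S : ι → κ, Real.exp ((Finset.card {j | p j (S j)} : ℝ) * Real.log u) := by
    rw [← nsmul_eq_mul]
    refine (Finset.card_nsmul_le_sum _ _ _ fun S hS => ?_).trans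
      (Finset.sum_le_sum_of_subset_of_nonneg (Finset.filter_subset _ _)
        fun _ _ _ => (Real.exp_pos _).le)
    rw [Finset.mem_filter] at hS
    exact Real.exp_le_exp.2 (mul_le_mul_of_nonneg_right hS.2 (Real.log_nonneg hu))
  rw [Real.exp_sub, ← mul_div_assoc, le_div_iff₀ (Real.exp_pos _)]
  refine h3.trans ?_
  simp_rw [h1] at hgen
  rw [hgen]
  refine (Finset.prod_le_prod (fun j _ => Finset.sum_nonneg fun l _ => ?_)
    fun j _ => h2 j).trans ?_
  · split_ifs <;> linarith
  · rw [Finset.prod_mul_distrib, ← Real.exp_sum, Finset.prod_const, Finset.card_univ,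
      Finset.mul_sum, Finset.sum_div]

end ProductCounting

/-! ### Quantization of a distribution, and nonemptiness of the source -/

lemma sInf_le_iff_le_cdf (ν : Measure ℝ) {u : ℝ} (h0 : 0 < u) (h1 : u < 1)
    (t : ℝ) : sInf {x | u ≤ cdf ν x} ≤ t ↔ u ≤ cdf ν t := by
  have hne : {x | u ≤ cdf ν x}.Nonempty :=
    ((tendsto_cdf_atTop ν).eventually (eventually_ge_nhds h1)).exists
  have hbdd : BddBelow {x | u ≤ cdf ν x} := by
    obtain ⟨c, hc⟩ := ((tendsto_cdf_atBot ν).eventually (eventually_lt_nhds h0)).exists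
    exact ⟨c, fun x hx => le_of_not_gt fun hlt =>
      absurd (hx.trans (monotone_cdf ν hlt.le)) (not_le.2 hc)⟩
  refine ⟨fun h => ?_, fun h => csInf_le hbdd h⟩
  have hr : Tendsto (cdf ν) (𝓝[>] t) (𝓝 (cdf ν t)) :=
    ((cdf ν).right_continuous t).tendsto.mono_left (nhdsWithin_mono _ Set.Ioi_subset_Ici_self)
  refine ge_of_tendsto hr ?_
  filter_upwards [self_mem_nhdsWithin] with y hy
  obtain ⟨x, hx, hxy⟩ := exists_lt_of_csInf_lt hne (h.trans_lt hy)
  exact le_trans hx (monotone_cdf ν hxy.le)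

/-- If the quantile at level `u` were `0`, then `F y < u ≤ F 0` for all `y < 0`; without an atom at
`0`, `F` is continuous there, which forces `u = F 0`. -/
lemma sInf_le_cdf_ne_zero (ν : Measure ℝ) [IsProbabilityMeasure ν] (hν : ν {0} = 0) {u : ℝ}
    (h0 : 0 < u) (h1 : u < 1) (hu : u ≠ cdf ν 0) : sInf {x | u ≤ cdf ν x} ≠ 0 := by
  intro h
  refine hu (le_antisymm ((sInf_le_iff_le_cdf ν h0 h1 0).1 h.le) ?_)
  have hs : ENNReal.ofReal (cdf ν 0 - Function.leftLim (cdf ν) 0) = 0 := by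
    rw [← StieltjesFunction.measure_singleton, measure_cdf, hν]
  have hle : cdf ν 0 ≤ Function.leftLim (cdf ν) 0 := by
    have := ENNReal.ofReal_eq_zero.1 hs
    linarith
  refine hle.trans (le_of_tendsto ((monotone_cdf ν).tendsto_leftLim 0) ?_)
  filter_upwards [self_mem_nhdsWithin] with y hy
  by_contra hlt
  have := (sInf_le_iff_le_cdf ν h0 h1 y).2 (not_le.1 hlt).le
  rw [h] at this
  exact absurd hy (not_lt.2 this)

lemma abs_card_filter_add_le_sub_le (k : ℕ) {θ y : ℝ} (h0 : 0 < θ) (h1 : θ < 1) (hy0 : 0 ≤ y)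
    (hyk : y ≤ k) : |(Finset.card {j : Fin k | (j : ℝ) + θ ≤ y} : ℝ) - y| ≤ 1 := by
  have hcard : Finset.card {j : Fin k | (j : ℝ) + θ ≤ y} = ⌊y + 1 - θ⌋₊ := by
    have : ∀ j : ℕ, (j : ℝ) + θ ≤ y ↔ j < ⌊y + 1 - θ⌋₊ := by
      intro j
      rw [← Nat.succ_le_iff, Nat.le_floor_iff (by linarith)]
      push_cast
      constructor <;> intro h <;> linarith
    simp_rw [this]
    have hk : ⌊y + 1 - θ⌋₊ ≤ k := by
      refine Nat.le_of_lt_succ ((Nat.floor_lt (by linarith)).2 ?_)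
      push_cast
      linarith
    rw [Fin.card_filter_val_lt, min_eq_right hk]
  rw [hcard]
  have ha := Nat.floor_le (show 0 ≤ y + 1 - θ by linarith)
  have hb := Nat.lt_floor_add_one (y + 1 - θ)
  rw [abs_le]
  constructor <;> linarith

/-- A distribution without an atom at `0` is approximated by `k` nonzero points, to within `1 / k`
in the Kolmogorov distance. -/
lemma exists_quantization (ν : Measure ℝ) [IsProbabilityMeasure ν] (hν : ν {0} = 0) (k : ℕ) :
    ∃ v : Fin k → ℝ, (∀ j, v j ≠ 0) ∧
      ∀ t, |(Finset.card {j | v j ≤ t} : ℝ) - k * cdf ν t| ≤ 1 := by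
  -- The points are the quantiles at levels `(j + θ) / k`. Only finitely many offsets `θ` make some
  -- level equal to `F 0`, the one level whose quantile could be `0`.
  obtain ⟨θ, hθ, hθ'⟩ : ∃ θ ∈ Set.Ioo (0 : ℝ) 1,
      θ ∉ Set.range (fun j : Fin k => k * cdf ν 0 - (j : ℝ)) :=
    ((Set.Ioo_infinite one_pos).sdiff (Set.finite_range _)).nonempty
  have hu0 : ∀ j : Fin k, 0 < ((j : ℝ) + θ) / k := fun j => by
    have : (0 : ℝ) < k := by exact_mod_cast j.pos
    have := hθ.1
    positivity
  have hu1 : ∀ j : Fin k, ((j : ℝ) + θ) / k < 1 := fun j => by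
    have hk : (0 : ℝ) < k := by exact_mod_cast j.pos
    rw [div_lt_one hk]
    have : (j : ℝ) + 1 ≤ k := by exact_mod_cast j.isLt
    linarith [hθ.2]
  refine ⟨fun j => sInf {x | ((j : ℝ) + θ) / k ≤ cdf ν x}, fun j => ?_, fun t => ?_⟩
  · refine sInf_le_cdf_ne_zero ν hν (hu0 j) (hu1 j) fun h => hθ' ⟨j, ?_⟩
    have hk : (0 : ℝ) < k := by exact_mod_cast j.pos
    rw [div_eq_iff hk.ne'] at h
    simp only
    linarith
  · have : ∀ j : Fin k, sInf {x | ((j : ℝ) + θ) / k ≤ cdf ν x} ≤ t ↔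
        (j : ℝ) + θ ≤ k * cdf ν t := by
      intro j
      have hk : (0 : ℝ) < k := by exact_mod_cast j.pos
      rw [sInf_le_iff_le_cdf ν (hu0 j) (hu1 j), div_le_iff₀ hk, mul_comm]
    simp_rw [this]
    exact abs_card_filter_add_le_sub_le k hθ.1 hθ.2
      (mul_nonneg (Nat.cast_nonneg k) (cdf_nonneg ν t))
      (mul_le_of_le_one_right (Nat.cast_nonneg k) (cdf_le_one ν t))

lemma empiricalCDF_eq {n : ℕ} (x : Fin n → ℝ) (t : ℝ) :
    empiricalCDF x t = (Finset.card {i ∈ pattern x | x i ≤ t} : ℝ) / (pattern x).card := by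
  rw [empiricalCDF, Finset.sum_boole]
  ring

lemma floor_mul_le {Ω : ℝ} (hΩ1 : Ω ≤ 1) (n : ℕ) : ⌊Ω * (n : ℝ)⌋₊ ≤ n :=
  Nat.floor_le_of_le (mul_le_of_le_one_left (Nat.cast_nonneg n) hΩ1)

/-- Achievability is vacuous for an empty source, so the converse needs an actual sequence to start
from. The quantization points are placed on the first `⌊Ω n⌋` coordinates. -/
theorem source_nonempty (ν : Measure ℝ) [IsProbabilityMeasure ν] (hν : ν {0} = 0) {Ω : ℝ}
    (hΩ : 0 < Ω) (hΩ1 : Ω ≤ 1) : (source Ω ν).Nonempty := by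
  choose v hv0 hv using exists_quantization ν hν
  let e : (n : ℕ) → Fin ⌊Ω * (n : ℝ)⌋₊ ↪ Fin n := fun n => Fin.castLEEmb (floor_mul_le hΩ1 n)
  let x : (n : ℕ) → Fin n → ℝ := fun n => Function.extend (e n) (v _) 0
  have hxe : ∀ n j, x n (e n j) = v _ j := fun n j => (e n).injective.extend_apply _ _ _
  have hpat : ∀ n, pattern (x n) = Finset.univ.map (e n) := by
    intro n
    ext i
    simp only [pattern, Finset.mem_filter, Finset.mem_univ, true_and, Finset.mem_map]
    constructor
    · intro h
      by_contra hi
      exact h (Function.extend_apply' _ _ _ hi)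
    · rintro ⟨j, rfl⟩
      rw [hxe]
      exact hv0 _ _
  have hcard : ∀ n, (pattern (x n)).card = ⌊Ω * (n : ℝ)⌋₊ := by
    intro n; rw [hpat]; simp
  refine ⟨x, hcard, ?_⟩
  have hkt : Tendsto (fun n : ℕ => 1 / (⌊Ω * (n : ℝ)⌋₊ : ℝ)) atTop (𝓝 0) := by
    refine tendsto_const_nhds.div_atTop (tendsto_natCast_atTop_atTop.comp
      (tendsto_nat_floor_atTop.comp ?_))
    exact tendsto_natCast_atTop_atTop.const_mul_atTop hΩ
  have hkpos : ∀ᶠ n : ℕ in atTop, 0 < ⌊Ω * (n : ℝ)⌋₊ :=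
    (tendsto_nat_floor_atTop.comp (tendsto_natCast_atTop_atTop.const_mul_atTop
      hΩ)).eventually_gt_atTop 0
  rw [Metric.tendstoUniformly_iff]
  intro ε hε
  filter_upwards [hkt.eventually (eventually_lt_nhds hε), hkpos] with n hn hk t
  refine lt_of_le_of_lt ?_ hn
  have hk' : (0 : ℝ) < ⌊Ω * (n : ℝ)⌋₊ := by exact_mod_cast hk
  rw [empiricalCDF_eq, hcard, hpat, Finset.filter_map, Finset.card_map, dist_comm, Real.dist_eq]
  have hcomp : ((fun i => x n i ≤ t) ∘ e n) = fun j => v _ j ≤ t := by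
    ext j; simp only [Function.comp_apply, hxe]
  simp only [hcomp]
  have h := hv ⌊Ω * (n : ℝ)⌋₊ t
  rw [show (Finset.card {j | v ⌊Ω * (n : ℝ)⌋₊ j ≤ t} : ℝ) / (⌊Ω * (n : ℝ)⌋₊ : ℝ) - cdf ν t =
      ((Finset.card {j | v ⌊Ω * (n : ℝ)⌋₊ j ≤ t} : ℝ) - ⌊Ω * (n : ℝ)⌋₊ * cdf ν t) /
        (⌊Ω * (n : ℝ)⌋₊ : ℝ) by field_simp, abs_div, abs_of_pos hk']
  exact div_le_div_of_nonneg_right h hk'.le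

lemma mem_pattern {n : ℕ} {x : Fin n → ℝ} {i : Fin n} : i ∈ pattern x ↔ x i ≠ 0 := by
  simp [pattern]

/-! ### Vectors with one moving nonzero element per block -/

section BlockVec

variable {n b B : ℕ} (z : Fin n → ℝ) (w : Fin b → ℝ) (pos : Fin b × Fin B ↪ Fin n)

/-- The vector `z` with, for each block `j`, the element `w j` added at the position `S j` of the
block. -/
noncomputable def blockVec (S : Fin b → Fin B) : Fin n → ℝ :=
  z + ∑ j, Pi.single (pos (j, S j)) (w j)

/-- The positions of the moving elements. -/
def blockEmb (S : Fin b → Fin B) : Fin b ↪ Fin n :=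
  ⟨fun j => pos (j, S j), fun i j h => by simpa using congrArg Prod.fst (pos.injective h)⟩

lemma blockVec_mulVec {m : ℕ} (A : Matrix (Fin m) (Fin n) ℝ) (S : Fin b → Fin B) (i : Fin m) :
    (A *ᵥ blockVec z w pos S) i = (A *ᵥ z) i + ∑ j, A i (pos (j, S j)) * w j := by
  simp only [blockVec, Matrix.mulVec_add, Matrix.mulVec_sum, Pi.add_apply, Finset.sum_apply,
    Matrix.mulVec_single, op_smul_eq_mul, Pi.smul_apply, Matrix.col_apply]

variable {z w pos}

lemma blockVec_apply_blockEmb (hz : ∀ p, z (pos p) = 0) (S : Fin b → Fin B) (j : Fin b) :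
    blockVec z w pos S (blockEmb pos S j) = w j := by
  simp only [blockVec, Pi.add_apply, Finset.sum_apply, Pi.single_apply]
  rw [show z (blockEmb pos S j) = 0 from hz _, zero_add]
  have : ∀ i, (blockEmb pos S j = pos (i, S i)) ↔ j = i := fun i =>
    (blockEmb pos S).injective.eq_iff (a := j) (b := i)
  simp [this]

lemma blockVec_apply_of_notMem (S : Fin b → Fin B) {i : Fin n}
    (hi : i ∉ Finset.univ.map (blockEmb pos S)) : blockVec z w pos S i = z i := by
  simp only [blockVec, Pi.add_apply, Finset.sum_apply, Pi.single_apply]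
  rw [Finset.sum_eq_zero, add_zero]
  intro j _
  rw [if_neg]
  rintro rfl
  exact hi (Finset.mem_map_of_mem _ (Finset.mem_univ j))

lemma disjoint_pattern_blockEmb (hz : ∀ p, z (pos p) = 0) (S : Fin b → Fin B) :
    Disjoint (pattern z) (Finset.univ.map (blockEmb pos S)) := by
  rw [Finset.disjoint_left]
  intro i hi hi'
  obtain ⟨j, -, rfl⟩ := Finset.mem_map.1 hi'
  exact mem_pattern.1 hi (hz _)

lemma pattern_blockVec (hz : ∀ p, z (pos p) = 0) (hw : ∀ j, w j ≠ 0) (S : Fin b → Fin B) :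
    pattern (blockVec z w pos S) =
      (pattern z).disjUnion (Finset.univ.map (blockEmb pos S))
        (disjoint_pattern_blockEmb hz S) := by
  ext i
  rw [mem_pattern, Finset.mem_disjUnion]
  by_cases hi : i ∈ Finset.univ.map (blockEmb pos S)
  · simp only [hi, or_true, iff_true]
    obtain ⟨j, -, rfl⟩ := Finset.mem_map.1 hi
    rw [blockVec_apply_blockEmb hz]
    exact hw j
  · rw [blockVec_apply_of_notMem S hi, mem_pattern]
    simp [hi]

lemma card_pattern_blockVec (hz : ∀ p, z (pos p) = 0) (hw : ∀ j, w j ≠ 0) (S : Fin b → Fin B) :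
    (pattern (blockVec z w pos S)).card = (pattern z).card + b := by
  rw [pattern_blockVec hz hw, Finset.card_disjUnion, Finset.card_map, Finset.card_univ,
    Fintype.card_fin]

lemma sum_pattern_blockVec (hz : ∀ p, z (pos p) = 0) (hw : ∀ j, w j ≠ 0) (S : Fin b → Fin B)
    (f : ℝ → ℝ) : ∑ i ∈ pattern (blockVec z w pos S), f (blockVec z w pos S i) =
      ∑ i ∈ pattern z, f (z i) + ∑ j, f (w j) := by
  rw [pattern_blockVec hz hw, Finset.sum_disjUnion, Finset.sum_map]
  congr 1
  · refine Finset.sum_congr rfl fun i hi => ?_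
    rw [blockVec_apply_of_notMem S (Finset.disjoint_left.1 (disjoint_pattern_blockEmb hz S) hi)]
  · refine Finset.sum_congr rfl fun j _ => ?_
    rw [blockVec_apply_blockEmb hz]

/-- For a fixed set `T` of `k` indices, few of the vectors have a pattern that `T` approximates. -/
lemma card_distortion_le (hz : ∀ p, z (pos p) = 0) (hw : ∀ j, w j ≠ 0) {α u : ℝ}
    (hB : (B : ℝ) = 2 * u) (hu : 1 ≤ u) (hb : 0 < b)
    (hα : 2 * (α * ((pattern z).card + b : ℕ)) ≤ b + 1) (T : Finset (Fin n))
    (hT : T.card = (pattern z).card + b) :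
    (Finset.card {S : Fin b → Fin B | distortion (pattern (blockVec z w pos S)) T ≤ α} : ℝ) ≤
      (B : ℝ) ^ b *
        Real.exp (-(b / 2 * (Real.log u - 1 + 1 / u) - Real.log u / 2)) := by
  classical
  have hu0 : 0 < u := by linarith
  have hBpos : (0 : ℝ) < B := by rw [hB]; linarith
  have : Nonempty (Fin B) := ⟨⟨0, by exact_mod_cast hBpos⟩⟩
  set k := (pattern z).card + b with hk
  set g := (pattern z ∩ T).card with hg
  have hkpos : (0 : ℝ) < (k : ℕ) := by
    have : 0 < k := by omega
    exact_mod_cast this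
  have hinter : ∀ S : Fin b → Fin B, (pattern (blockVec z w pos S) ∩ T).card =
      g + Finset.card {j | pos (j, S j) ∈ T} := by
    intro S
    rw [pattern_blockVec hz hw, Finset.disjUnion_eq_union, Finset.union_inter_distrib_right,
      Finset.card_union_of_disjoint ((disjoint_pattern_blockEmb hz S).mono
        Finset.inter_subset_left Finset.inter_subset_left)]
    congr 1
    rw [← Finset.card_map (blockEmb pos S)]
    congr 1
    ext i
    simp only [Finset.mem_inter, Finset.mem_map, Finset.mem_univ, true_and, Finset.mem_filter]
    constructor
    · rintro ⟨⟨j, rfl⟩, h⟩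
      exact ⟨j, h, rfl⟩
    · rintro ⟨j, h, rfl⟩
      exact ⟨⟨j, rfl⟩, h⟩
  -- The `g` elements of `T` spent on the pattern of `z` lie outside all blocks, so at most `k - g`
  -- cells remain and the expected number of hits is at most `(k - g) / B`.
  have hcells : ∑ j : Fin b, (Finset.card {l : Fin B | pos (j, l) ∈ T} : ℝ) ≤ (k : ℝ) - g := by
    have h1 : ∑ j : Fin b, Finset.card {l : Fin B | pos (j, l) ∈ T} =
        Finset.card {p : Fin b × Fin B | pos p ∈ T} := by
      simp_rw [Finset.card_filter]
      rw [Fintype.sum_prod_type]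
    have h2 : Finset.card {p : Fin b × Fin B | pos p ∈ T} ≤ (T \ pattern z).card := by
      rw [← Finset.card_map pos]
      refine Finset.card_le_card fun i hi => ?_
      obtain ⟨p, hp, rfl⟩ := Finset.mem_map.1 hi
      rw [Finset.mem_sdiff, mem_pattern, not_not]
      exact ⟨(Finset.mem_filter.1 hp).2, hz p⟩
    have h3 : (T \ pattern z).card + g = k := by
      rw [hg, Finset.inter_comm, Finset.card_sdiff_add_card_inter, hT]
    have h4 : ((T \ pattern z).card : ℝ) + g = k := by exact_mod_cast h3
    have h5 : ((∑ j : Fin b, Finset.card {l : Fin B | pos (j, l) ∈ T} : ℕ) : ℝ) ≤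
        ((T \ pattern z).card : ℝ) := by exact_mod_cast h1 ▸ h2
    push_cast at h5
    linarith
  have hsub : ∀ S : Fin b → Fin B, distortion (pattern (blockVec z w pos S)) T ≤ α →
      (1 - α) * k - g ≤ (Finset.card {j | pos (j, S j) ∈ T} : ℝ) := by
    intro S hS
    rw [distortion, card_pattern_blockVec hz hw, hinter] at hS
    have : 1 - α ≤ ((g + Finset.card {j | pos (j, S j) ∈ T} : ℕ) : ℝ) / (k : ℕ) := by linarith
    rw [le_div_iff₀ hkpos] at this
    push_cast at this
    linarith
  have hcount := card_hits_le (fun (j : Fin b) (l : Fin B) => pos (j, l) ∈ T) u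
    ((1 - α) * k - g) hu
  simp only [Fintype.card_fin] at hcount
  refine le_trans ?_ (hcount.trans ?_)
  · exact_mod_cast Finset.card_le_card fun S hS => by
      rw [Finset.mem_filter] at hS ⊢
      exact ⟨hS.1, hsub S hS.2⟩
  · gcongr
    have hlog := Real.one_sub_inv_le_log_of_pos hu0
    have hlog0 := Real.log_nonneg hu
    have hgb : (b : ℝ) ≤ k - g := by
      have : g ≤ (pattern z).card := Finset.card_le_card Finset.inter_subset_left
      have : b + g ≤ k := by omega
      have : (b : ℝ) + g ≤ k := by exact_mod_cast this
      linarith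
    have hstep : (u - 1) * (∑ j : Fin b, (Finset.card {l : Fin B | pos (j, l) ∈ T} : ℝ)) / B ≤
        (k - g) * ((1 - 1 / u) / 2) := by
      rw [hB, div_le_iff₀ (by linarith)]
      calc _ ≤ (u - 1) * ((k : ℝ) - g) := mul_le_mul_of_nonneg_left hcells (by linarith)
        _ = _ := by field_simp
    -- The bracket is nonpositive, so the best `T` contains the whole pattern of `z`, that is, `k -
    -- g = b`.
    have hq : ((k : ℝ) - g) * ((1 - 1 / u) / 2 - Real.log u) ≤
        b * ((1 - 1 / u) / 2 - Real.log u) := by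
      refine mul_le_mul_of_nonpos_right hgb ?_
      have : 0 ≤ 1 - 1 / u := by
        rw [sub_nonneg, div_le_one hu0]; exact hu
      rw [inv_eq_one_div] at hlog
      linarith
    have hα' : α * k * Real.log u ≤ (b + 1) / 2 * Real.log u :=
      mul_le_mul_of_nonneg_right (by linarith) hlog0
    nlinarith [hstep, hq, hα']

end BlockVec

/-! ### Measurability and the error probability -/

lemma measurable_matrix_apply {m n : ℕ} (i : Fin m) (j : Fin n) :
    Measurable (fun A : Matrix (Fin m) (Fin n) ℝ => A i j) :=
  (measurable_pi_apply j).comp (measurable_pi_apply (X := fun _ : Fin m => Fin n → ℝ) i)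

lemma measurable_mulVec_add {m n : ℕ} (x : Fin n → ℝ) :
    Measurable (fun p : Matrix (Fin m) (Fin n) ℝ × (Fin m → ℝ) => p.1 *ᵥ x + p.2) := by
  refine measurable_pi_lambda _ fun i => ?_
  simp only [Pi.add_apply, Matrix.mulVec, dotProduct]
  refine Measurable.add (Finset.measurable_sum _ fun j _ => ?_)
    ((measurable_pi_apply i).comp measurable_snd)
  exact ((measurable_matrix_apply i j).comp measurable_fst).mul_const _

lemma measurableSet_distortion_le {m n : ℕ} (S : Estimator m n) (s : Finset (Fin n)) (k : ℕ)
    (α : ℝ) : MeasurableSet {p : (Fin m → ℝ) × Matrix (Fin m) (Fin n) ℝ |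
      distortion s (S.toFun p.1 p.2 k) ≤ α} := by
  have : {p : (Fin m → ℝ) × Matrix (Fin m) (Fin n) ℝ | distortion s (S.toFun p.1 p.2 k) ≤ α} =
      ⋃ T ∈ {T : Finset (Fin n) | distortion s T ≤ α},
        {p : (Fin m → ℝ) × Matrix (Fin m) (Fin n) ℝ | S.toFun p.1 p.2 k = T} := by
    ext p; simp
  rw [this]
  exact MeasurableSet.biUnion (Set.toFinite _).countable fun T _ => S.measurableSet_fiber k T

/-- The event that the pattern of `x` is recovered with distortion at most `α`. -/
def successSet {m n : ℕ} (S : Estimator m n) (α : ℝ) (x : Fin n → ℝ) :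
    Set (Matrix (Fin m) (Fin n) ℝ × (Fin m → ℝ)) :=
  {p | distortion (pattern x) (S.toFun (p.1 *ᵥ x + p.2) p.1 (pattern x).card) ≤ α}

lemma measurableSet_successSet {m n : ℕ} (S : Estimator m n) (α : ℝ) (x : Fin n → ℝ) :
    MeasurableSet (successSet S α x) :=
  ((measurable_mulVec_add x).prodMk measurable_fst)
    (measurableSet_distortion_le S (pattern x) (pattern x).card α)

lemma half_le_integral_success {m n : ℕ} (Q : Measure (Matrix (Fin m) (Fin n) ℝ))
    [IsProbabilityMeasure Q] (S : Estimator m n) (α : ℝ) (x : Fin n → ℝ)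
    (h : errorProb Q S α x ≤ 1 / 2) :
    1 / 2 ≤ ∫ A, (noise m).real (Prod.mk A ⁻¹' successSet S α x) ∂Q := by
  have hm := measurableSet_successSet S α x
  have h1 : ∫ A, (noise m).real (Prod.mk A ⁻¹' successSet S α x) ∂Q =
      (Q.prod (noise m)).real (successSet S α x) := by
    simp only [Measure.real]
    rw [integral_toReal (measurable_measure_prodMk_left hm).aemeasurable
      (ae_of_all _ fun _ => measure_lt_top _ _), Measure.prod_apply hm]
  have h2 : (Q.prod (noise m)).real (successSet S α x)ᶜ ≤ 1 / 2 := by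
    have : (successSet S α x)ᶜ = {p : Matrix (Fin m) (Fin n) ℝ × (Fin m → ℝ) |
        α < distortion (pattern x) (S.toFun (p.1 *ᵥ x + p.2) p.1 (pattern x).card)} := by
      ext p; simp [successSet]
    rw [this]
    have := ENNReal.toReal_mono (by simp) h
    simpa [errorProb, Measure.real] using this
  rw [probReal_compl_eq_one_sub hm] at h2
  rw [h1]
  linarith

/-! ### Fano-type inequality for the block vectors -/

section Converse

variable {m n b B : ℕ} {z : Fin n → ℝ} {w : Fin b → ℝ} {pos : Fin b × Fin B ↪ Fin n}

/-- The average of `A x` over the vectors `x` with one moving nonzero element per block. -/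
noncomputable def meanSample (z : Fin n → ℝ) (w : Fin b → ℝ) (pos : Fin b × Fin B ↪ Fin n)
    (A : Matrix (Fin m) (Fin n) ℝ) : Fin m → ℝ :=
  fun i => (A *ᵥ z) i + ∑ j, (∑ l, A i (pos (j, l)) * w j) / B

lemma trace_mul_transpose_eq (A : Matrix (Fin m) (Fin n) ℝ) :
    (A * Aᵀ).trace = ∑ i, ∑ j, A i j ^ 2 := by
  simp [Matrix.trace, Matrix.mul_apply, sq]

/-- In each row the fluctuation is a sum of independent centred terms, one per block, so variances
add. Averaging over a block divides `w j ^ 2` by `B`, and disjointness of the blocks bounds the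
total by the squared norm of the row. -/
lemma sum_sq_sub_meanSample_le (hB : 0 < B) {lam : ℝ} (hlam : ∀ j, w j ^ 2 ≤ lam * B)
    (hlam0 : 0 ≤ lam) (A : Matrix (Fin m) (Fin n) ℝ) :
    ∑ S : Fin b → Fin B, ∑ i, ((A *ᵥ blockVec z w pos S - meanSample z w pos A) i) ^ 2 ≤
      (B : ℝ) ^ b * (lam * (A * Aᵀ).trace) := by
  have : Nonempty (Fin B) := ⟨⟨0, hB⟩⟩
  have hB' : (0 : ℝ) < B := by exact_mod_cast hB
  rw [Finset.sum_comm, trace_mul_transpose_eq, Finset.mul_sum, Finset.mul_sum]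
  refine Finset.sum_le_sum fun i _ => ?_
  have h1 := sum_pi_sq_sum_sub_mean_le (fun (j : Fin b) (l : Fin B) => A i (pos (j, l)) * w j)
  simp only [Fintype.card_fin] at h1
  have h2 : ∀ S : Fin b → Fin B, (A *ᵥ blockVec z w pos S - meanSample z w pos A) i =
      ∑ j, (A i (pos (j, S j)) * w j - (∑ l, A i (pos (j, l)) * w j) / B) := by
    intro S
    rw [Pi.sub_apply, blockVec_mulVec, meanSample, Finset.sum_sub_distrib]
    ring
  simp_rw [h2]
  refine h1.trans (mul_le_mul_of_nonneg_left ?_ (by positivity))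
  calc ∑ j, (∑ l, (A i (pos (j, l)) * w j) ^ 2) / (B : ℝ)
      ≤ ∑ j, ∑ l, lam * A i (pos (j, l)) ^ 2 := by
        refine Finset.sum_le_sum fun j _ => ?_
        rw [div_le_iff₀ hB', Finset.sum_mul]
        refine Finset.sum_le_sum fun l _ => ?_
        nlinarith [mul_le_mul_of_nonneg_left (hlam j) (sq_nonneg (A i (pos (j, l))))]
    _ = lam * ∑ p, A i (pos p) ^ 2 := by
        rw [← Fintype.sum_prod_type (f := fun p => lam * A i (pos p) ^ 2), Finset.mul_sum]
    _ = lam * ∑ t ∈ Finset.univ.map pos, A i t ^ 2 := by rw [Finset.sum_map]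
    _ ≤ lam * ∑ t, A i t ^ 2 := by
        refine mul_le_mul_of_nonneg_left ?_ hlam0
        exact Finset.sum_le_sum_of_subset_of_nonneg (Finset.subset_univ _)
          fun _ _ _ => sq_nonneg _

/-- Fano-type inequality for a fixed sampling matrix. -/
lemma sum_success_le (hz : ∀ p, z (pos p) = 0) (hw : ∀ j, w j ≠ 0) {α γ lam : ℝ} {k : ℕ}
    (hk : k = (pattern z).card + b) (hB : 0 < B)
    (hcount : ∀ T : Finset (Fin n), T.card = k →
      (Finset.card {S : Fin b → Fin B | distortion (pattern (blockVec z w pos S)) T ≤ α} : ℝ) ≤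
        (B : ℝ) ^ b * Real.exp (-γ))
    (hlam0 : 0 ≤ lam) (hlam : ∀ j, w j ^ 2 ≤ lam * B) (hkn : k ≤ n)
    (est : Estimator m n) (A : Matrix (Fin m) (Fin n) ℝ) :
    ∑ S : Fin b → Fin B, γ * (noise m).real
        (Prod.mk A ⁻¹' successSet est α (blockVec z w pos S)) ≤
      (B : ℝ) ^ b * (m * (Real.log (1 + lam) / 2 - 1 / 2 + 1 / (2 * (1 + lam))) + 1 +
        lam * (A * Aᵀ).trace / (2 * (1 + lam))) := by
  classical
  set s : ℝ≥0 := ⟨1 + lam, by linarith⟩ with hs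
  have hs' : (s : ℝ) = 1 + lam := rfl
  have hspos : 0 < s := by
    rw [← NNReal.coe_pos, hs']; linarith
  set c := meanSample z w pos A with hc
  set E : (Fin b → Fin B) → Set (Fin m → ℝ) := fun S =>
    {v | distortion (pattern (blockVec z w pos S)) (est.toFun (c + v) A k) ≤ α} with hE
  have hEm : ∀ S, MeasurableSet (E S) := fun S =>
    ((measurable_const_add c).prodMk measurable_const)
      (measurableSet_distortion_le est (pattern (blockVec z w pos S)) k α)
  have hset : ∀ S, Prod.mk A ⁻¹' successSet est α (blockVec z w pos S) =
      {v | (A *ᵥ blockVec z w pos S - c) + v ∈ E S} := by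
    intro S
    ext v
    simp only [successSet, hE, Set.mem_preimage, Set.mem_ofPred_eq]
    rw [card_pattern_blockVec hz hw, ← hk, ← add_assoc, add_sub_cancel]
  have h1 : ∀ S, γ * (noise m).real (Prod.mk A ⁻¹' successSet est α (blockVec z w pos S)) ≤
      m * (Real.log (1 + lam) / 2 - 1 / 2 + 1 / (2 * (1 + lam))) +
        (∑ i, ((A *ᵥ blockVec z w pos S - c) i) ^ 2) / (2 * (1 + lam)) +
          Real.exp γ * (gaussianRef m s).real (E S) := by
    intro S
    rw [hset S]
    exact mul_noise_real_le s hspos _ γ (E S) (hEm S)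
  -- Under the reference law the observation does not depend on `S`. Exchanging sum and integral
  -- leaves, for each observation, the number of `S` that one fixed estimate approximates.
  have h2 : ∑ S, (gaussianRef m s).real (E S) ≤ (B : ℝ) ^ b * Real.exp (-γ) := by
    have h3 : ∀ S, (gaussianRef m s).real (E S) =
        ∫ v, (E S).indicator (fun _ => (1 : ℝ)) v ∂(gaussianRef m s) := by
      intro S
      rw [integral_indicator (hEm S)]
      simp
    have hint : ∀ S, Integrable ((E S).indicator (fun _ => (1 : ℝ))) (gaussianRef m s) :=
      fun S => (integrable_const _).indicator (hEm S)
    simp_rw [h3]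
    rw [← integral_finsetSum _ fun S _ => hint S]
    have h4 : ∀ v, ∑ S, (E S).indicator (fun _ => (1 : ℝ)) v ≤ (B : ℝ) ^ b * Real.exp (-γ) := by
      intro v
      refine le_trans (le_of_eq ?_) (hcount (est.toFun (c + v) A k) (est.card_eq _ _ _ hkn))
      rw [Finset.card_filter]
      push_cast
      refine Finset.sum_congr rfl fun S _ => ?_
      simp [Set.indicator_apply, hE]
    calc _ ≤ ∫ v, (B : ℝ) ^ b * Real.exp (-γ) ∂(gaussianRef m s) :=
          integral_mono (integrable_finsetSum _ fun S _ => hint S) (integrable_const _) h4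
      _ = _ := by simp
  have h5 := sum_sq_sub_meanSample_le (z := z) (pos := pos) hB hlam hlam0 A
  have hden : (0 : ℝ) < 2 * (1 + lam) := by linarith
  calc _ ≤ ∑ S : Fin b → Fin B, (m * (Real.log (1 + lam) / 2 - 1 / 2 + 1 / (2 * (1 + lam))) +
        (∑ i, ((A *ᵥ blockVec z w pos S - c) i) ^ 2) / (2 * (1 + lam)) +
          Real.exp γ * (gaussianRef m s).real (E S)) := Finset.sum_le_sum fun S _ => h1 S
    _ = (B : ℝ) ^ b * (m * (Real.log (1 + lam) / 2 - 1 / 2 + 1 / (2 * (1 + lam)))) +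
        (∑ S : Fin b → Fin B, ∑ i, ((A *ᵥ blockVec z w pos S - c) i) ^ 2) / (2 * (1 + lam)) +
          Real.exp γ * ∑ S, (gaussianRef m s).real (E S) := by
        rw [Finset.sum_add_distrib, Finset.sum_add_distrib, Finset.sum_div, Finset.mul_sum]
        simp
    _ ≤ (B : ℝ) ^ b * (m * (Real.log (1 + lam) / 2 - 1 / 2 + 1 / (2 * (1 + lam)))) +
        ((B : ℝ) ^ b * (lam * (A * Aᵀ).trace)) / (2 * (1 + lam)) +
          Real.exp γ * ((B : ℝ) ^ b * Real.exp (-γ)) := by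
        gcongr
    _ = _ := by
        rw [show Real.exp γ * ((B : ℝ) ^ b * Real.exp (-γ)) =
          (B : ℝ) ^ b * (Real.exp γ * Real.exp (-γ)) by ring, ← Real.exp_add, add_neg_cancel,
          Real.exp_zero]
        ring

/-- Fano-type inequality: if all the patterns with one moving element per block are recovered with
probability at least `1 / 2`, then the capacity bound on the information in the samples exceeds
half the exponent `γ`. -/
theorem half_exponent_le (hz : ∀ p, z (pos p) = 0) (hw : ∀ j, w j ≠ 0) {α γ lam : ℝ} {k : ℕ}
    (hk : k = (pattern z).card + b) (hB : 0 < B)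
    (hcount : ∀ T : Finset (Fin n), T.card = k →
      (Finset.card {S : Fin b → Fin B | distortion (pattern (blockVec z w pos S)) T ≤ α} : ℝ) ≤
        (B : ℝ) ^ b * Real.exp (-γ))
    (hlam0 : 0 ≤ lam) (hlam : ∀ j, w j ^ 2 ≤ lam * B) (hkn : k ≤ n)
    (Q : Measure (Matrix (Fin m) (Fin n) ℝ)) (hQ : IsSamplingLaw Q) (est : Estimator m n)
    (herr : ∀ S, errorProb Q est α (blockVec z w pos S) ≤ 1 / 2) :
    γ ≤ m * Real.log (1 + lam) + 2 := by
  have := hQ.isProbabilityMeasure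
  have hlog : 0 ≤ Real.log (1 + lam) := Real.log_nonneg (by linarith)
  rcases le_total γ 0 with hγ | hγ
  · have : 0 ≤ m * Real.log (1 + lam) := by positivity
    linarith
  have hBb : (0 : ℝ) < (B : ℝ) ^ b := by
    have : (0 : ℝ) < B := by exact_mod_cast hB
    positivity
  have hint : ∀ S, Integrable (fun A => γ * (noise m).real
      (Prod.mk A ⁻¹' successSet est α (blockVec z w pos S))) Q := fun S =>
    (Integrable.of_bound (C := 1) (measurable_measure_prodMk_left
      (measurableSet_successSet est α _)).ennreal_toReal.aestronglyMeasurable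
      (ae_of_all _ fun A => by
        rw [Real.norm_of_nonneg ENNReal.toReal_nonneg]
        exact measureReal_le_one)).const_mul γ
  have htr : Integrable (fun A : Matrix (Fin m) (Fin n) ℝ =>
      lam * (A * Aᵀ).trace / (2 * (1 + lam))) Q := (hQ.integrable_trace.const_mul lam).div_const _
  have hmono := integral_mono (integrable_finsetSum Finset.univ fun S _ => hint S)
    (((integrable_const _).add htr).const_mul _)
    (sum_success_le hz hw hk hB hcount hlam0 hlam hkn est)
  rw [integral_finsetSum _ fun S _ => hint S] at hmono
  simp only [Pi.add_apply] at hmono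
  rw [integral_const_mul, integral_add (integrable_const _) htr, integral_div,
    integral_const_mul, hQ.integral_trace] at hmono
  have hlow : (B : ℝ) ^ b * (γ / 2) ≤ ∑ S : Fin b → Fin B, ∫ A, γ * (noise m).real
      (Prod.mk A ⁻¹' successSet est α (blockVec z w pos S)) ∂Q := by
    calc (B : ℝ) ^ b * (γ / 2) = ∑ S : Fin b → Fin B, γ / 2 := by simp
      _ ≤ _ := by
        refine Finset.sum_le_sum fun S _ => ?_
        rw [integral_const_mul]
        have := mul_le_mul_of_nonneg_left
          (half_le_integral_success Q est α _ (herr S)) hγ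
        linarith
  have hfin := le_of_mul_le_mul_left (hlow.trans hmono) hBb
  simp only [integral_const, probReal_univ, one_smul] at hfin
  have hne : (1 + lam) ≠ 0 := by linarith
  -- With reference variance `1 + lam` and average energy at most `lam * m`, the terms not involving
  -- the logarithm cancel.
  have : m * (Real.log (1 + lam) / 2 - 1 / 2 + 1 / (2 * (1 + lam))) + 1 +
      lam * m / (2 * (1 + lam)) = m * Real.log (1 + lam) / 2 + 1 := by
    field_simp
    ring
  linarith

end Converse

/-! ### From achievability to the asymptotic converse -/

/-- Along a source sequence, the error probability is eventually at most `1 / 2`, uniformly over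
the vectors with the same sparsity and the same empirical distribution. -/
lemma eventually_errorProb_le {Ω α : ℝ} {ν : Measure ℝ} {m : ℕ → ℕ}
    (Q : (n : ℕ) → Measure (Matrix (Fin (m n)) (Fin n) ℝ)) (est : (n : ℕ) → Estimator (m n) n)
    (hach : ∀ x ∈ source Ω ν, Tendsto (fun n => errorProb (Q n) (est n) α (x n)) atTop (𝓝 0))
    {x : (n : ℕ) → Fin n → ℝ} (hx : x ∈ source Ω ν) :
    ∀ᶠ n in atTop, ∀ y : Fin n → ℝ, (pattern y).card = (pattern (x n)).card →
      (∀ t, empiricalCDF y t = empiricalCDF (x n) t) →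
        errorProb (Q n) (est n) α y ≤ 1 / 2 := by
  -- For each `n`, take a vector violating the bound if there is one. The resulting sequence still
  -- belongs to the source, whose definition involves only sparsity and empirical distributions;
  -- hence violations stop.
  have hex : ∀ n, ∃ y : Fin n → ℝ, ((pattern y).card = (pattern (x n)).card ∧
      ∀ t, empiricalCDF y t = empiricalCDF (x n) t) ∧
      (errorProb (Q n) (est n) α y ≤ 1 / 2 → ∀ y' : Fin n → ℝ,
        (pattern y').card = (pattern (x n)).card →
        (∀ t, empiricalCDF y' t = empiricalCDF (x n) t) →
          errorProb (Q n) (est n) α y' ≤ 1 / 2) := by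
    intro n
    by_cases h : ∀ y' : Fin n → ℝ, (pattern y').card = (pattern (x n)).card →
        (∀ t, empiricalCDF y' t = empiricalCDF (x n) t) → errorProb (Q n) (est n) α y' ≤ 1 / 2
    · exact ⟨x n, ⟨rfl, fun _ => rfl⟩, fun _ => h⟩
    · push Not at h
      obtain ⟨y, h1, h2, h3⟩ := h
      exact ⟨y, ⟨h1, h2⟩, fun h4 => absurd h4 (not_le.2 h3)⟩
  choose y hy hy' using hex
  have hys : y ∈ source Ω ν := by
    refine ⟨fun n => (hy n).1.trans (hx.1 n), ?_⟩
    have : (fun n => empiricalCDF (y n)) = fun n => empiricalCDF (x n) := by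
      ext n t; exact (hy n).2 t
    rw [this]
    exact hx.2
  have hev := (hach y hys).eventually (eventually_le_nhds (b := (1 / 2 : ℝ≥0∞)) (by simp))
  filter_upwards [hev] with n hn
  exact hy' n hn

/-- The elements with index in `G` of a vector can be made to move in disjoint blocks. -/
lemma exists_blockVec {n b B : ℕ} (x : Fin n → ℝ) (G : Finset (Fin n)) (hG : G ⊆ pattern x)
    (hGb : G.card = b) (hn : b * B + (pattern x).card ≤ n + b) :
    ∃ (z : Fin n → ℝ) (w : Fin b → ℝ) (pos : Fin b × Fin B ↪ Fin n),
      (∀ p, z (pos p) = 0) ∧ (∀ j, w j ≠ 0) ∧ (∀ j, ∃ i ∈ G, w j = x i) ∧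
      (pattern x).card = (pattern z).card + b ∧
      ∀ S, (pattern (blockVec z w pos S)).card = (pattern x).card ∧
        ∀ t, empiricalCDF (blockVec z w pos S) t = empiricalCDF x t := by
  classical
  set z : Fin n → ℝ := fun i => if i ∈ G then 0 else x i with hz
  set e := G.orderEmbOfFin hGb with he
  have hpz : pattern z = pattern x \ G := by
    ext i
    rw [mem_pattern, Finset.mem_sdiff, mem_pattern]
    by_cases h : i ∈ G <;> simp [hz, h]
  have hcz : (pattern z).card + b = (pattern x).card := by
    rw [hpz, ← hGb, Finset.card_sdiff_add_card_eq_card hG]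
  -- The blocks may occupy any position outside the pattern of `z`, including those vacated by `G`;
  -- the room condition counts exactly these.
  obtain ⟨f⟩ : Nonempty (Fin b × Fin B ↪ {i // i ∉ pattern z}) := by
    apply Function.Embedding.nonempty_of_card_le
    rw [Fintype.card_prod, Fintype.card_fin, Fintype.card_fin, Fintype.card_subtype_compl,
      Fintype.card_fin, Fintype.card_coe]
    omega
  have hG0 : ∀ i ∈ G, x i ≠ 0 := fun i hi => mem_pattern.1 (hG hi)
  have hzpos : ∀ p, z ((f.trans (Function.Embedding.subtype _)) p) = 0 := by
    intro p
    have := (f p).2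
    rw [mem_pattern, not_not] at this
    exact this
  have hw0 : ∀ j, x (e j) ≠ 0 := fun j => hG0 _ (G.orderEmbOfFin_mem hGb j)
  refine ⟨z, fun j => x (e j), f.trans (Function.Embedding.subtype _), hzpos, hw0,
    fun j => ⟨e j, G.orderEmbOfFin_mem hGb j, rfl⟩, hcz.symm, fun S => ?_⟩
  have hcard := card_pattern_blockVec (w := fun j => x (e j)) hzpos hw0 S
  rw [hcz] at hcard
  refine ⟨hcard, fun t => ?_⟩
  rw [empiricalCDF, empiricalCDF, hcard]
  congr 1
  rw [sum_pattern_blockVec hzpos hw0 S (fun v => if v ≤ t then (1 : ℝ) else 0), hpz,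
    ← Finset.sum_sdiff hG]
  congr 1
  · refine Finset.sum_congr rfl fun i hi => ?_
    simp only [hz, if_neg (Finset.mem_sdiff.1 hi).2]
  · have : G = Finset.univ.map e.toEmbedding := by
      ext i
      simp only [Finset.mem_map, Finset.mem_univ, true_and]
      have := G.range_orderEmbOfFin hGb
      rw [← Finset.mem_coe, ← this]
      rfl
    conv_rhs => rw [this]
    rw [Finset.sum_map]
    rfl

/-- Uniform convergence costs at most `α / 2` at each of `τ` and `-τ`, which leaves `2α` of the mass
`3α`. -/
lemma eventually_card_small_ge {Ω α τ : ℝ} {ν : Measure ℝ} (hα : 0 < α)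
    (hmass : 3 * α ≤ cdf ν τ - cdf ν (-τ)) {x : (n : ℕ) → Fin n → ℝ}
    (hx : x ∈ source Ω ν) :
    ∀ᶠ n in atTop, 2 * α * (pattern (x n)).card ≤
      (Finset.card {i ∈ pattern (x n) | |x n i| ≤ τ} : ℝ) := by
  have h1 := Metric.tendstoUniformly_iff.1 hx.2 (α / 2) (by linarith)
  filter_upwards [h1] with n hn
  have ha := (abs_lt.1 (hn τ)).2
  have hb := (abs_lt.1 (hn (-τ))).1
  rcases Nat.eq_zero_or_pos (pattern (x n)).card with h0 | hpos
  · simp [h0]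
  have hpos' : (0 : ℝ) < (pattern (x n)).card := by exact_mod_cast hpos
  have hlt : 2 * α ≤ empiricalCDF (x n) τ - empiricalCDF (x n) (-τ) := by linarith
  rw [empiricalCDF_eq, empiricalCDF_eq, ← sub_div, le_div_iff₀ hpos'] at hlt
  have hsub : Finset.card {i ∈ pattern (x n) | x n i ≤ τ} ≤
      Finset.card {i ∈ pattern (x n) | x n i ≤ -τ} +
        Finset.card {i ∈ pattern (x n) | |x n i| ≤ τ} := by
    rw [← Finset.card_union_add_card_inter]
    refine le_trans (Finset.card_le_card fun i hi => ?_) (Nat.le_add_right _ _)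
    rw [Finset.mem_union, Finset.mem_filter, Finset.mem_filter]
    rw [Finset.mem_filter] at hi
    by_cases h : x n i ≤ -τ
    · exact Or.inl ⟨hi.1, h⟩
    · exact Or.inr ⟨hi.1, abs_le.2 ⟨(not_le.1 h).le, hi.2⟩⟩
  have : (Finset.card {i ∈ pattern (x n) | x n i ≤ τ} : ℝ) ≤
      Finset.card {i ∈ pattern (x n) | x n i ≤ -τ} +
        Finset.card {i ∈ pattern (x n) | |x n i| ≤ τ} := by exact_mod_cast hsub
  linarith

/-- A converse for the recovery of the pattern of the small nonzero elements, of magnitude at most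
`τ`, when the support of the larger ones is known. -/
theorem converse_of_achievable {Ω α τ lam : ℝ} {B : ℕ} {ρ : ℝ≥0} (ν : Measure ℝ)
    [IsProbabilityMeasure ν] (hν : ν {0} = 0) (hΩ : 0 < Ω) (hΩ1 : Ω ≤ 1) (hα : 0 < α)
    (hα1 : α ≤ 1 / 2) (hB : 2 ≤ B) (hBΩ : 2 * α * Ω * (B - 1) ≤ 1 - Ω)
    (hmass : 3 * α ≤ cdf ν τ - cdf ν (-τ)) (hlam0 : 0 ≤ lam) (hlam : τ ^ 2 ≤ lam * B)
    (hach : Achievable (source Ω ν) ρ α) :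
    α * Ω * (Real.log (B / 2) - 1 + 1 / (B / 2)) ≤ ρ * Real.log (1 + lam) := by
  obtain ⟨Q, est, hQ, herr⟩ := hach
  obtain ⟨x, hx⟩ := source_nonempty ν hν hΩ hΩ1
  set u : ℝ := B / 2 with hu
  have hB' : (2 : ℝ) ≤ B := by exact_mod_cast hB
  have hu1 : 1 ≤ u := by rw [hu]; linarith
  set D := Real.log u - 1 + 1 / u with hD
  have hD0 : 0 ≤ D := by
    have := Real.one_sub_inv_le_log_of_pos (by linarith : 0 < u)
    rw [inv_eq_one_div] at this
    linarith
  have hlogl : 0 ≤ Real.log (1 + lam) := Real.log_nonneg (by linarith)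
  have hkt : Tendsto (fun n : ℕ => 2 * α * (⌊Ω * (n : ℝ)⌋₊ : ℝ)) atTop atTop :=
    (tendsto_natCast_atTop_atTop.comp (tendsto_nat_floor_atTop.comp
      (tendsto_natCast_atTop_atTop.const_mul_atTop hΩ))).const_mul_atTop (by linarith)
  have hmain : ∀ᶠ n : ℕ in atTop, (α * Ω * D - ρ * Real.log (1 + lam)) * n ≤
      D + Real.log u / 2 + Real.log (1 + lam) + 2 := by
    filter_upwards [eventually_errorProb_le Q est herr hx, eventually_card_small_ge hα hmass hx,
      hkt.eventually_ge_atTop 1] with n hn hsmall hk1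
    rw [hx.1 n] at hsmall
    set k := ⌊Ω * (n : ℝ)⌋₊ with hk
    set b := ⌊2 * α * (k : ℝ)⌋₊ with hb
    have hkn : k ≤ n := floor_mul_le hΩ1 n
    have hkΩ : (k : ℝ) ≤ Ω * n := Nat.floor_le (by positivity)
    have hkΩ' : Ω * n < k + 1 := Nat.lt_floor_add_one _
    have hbk : (b : ℝ) ≤ 2 * α * k := Nat.floor_le (by positivity)
    have hbk' : 2 * α * k < b + 1 := Nat.lt_floor_add_one _
    have hb0 : 0 < b := Nat.floor_pos.2 hk1
    obtain ⟨G, hGsub, hGcard⟩ := Finset.exists_subset_card_eq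
      (show b ≤ Finset.card {i ∈ pattern (x n) | |x n i| ≤ τ} by
        exact_mod_cast hbk.trans hsmall)
    have hroom : b * B + (pattern (x n)).card ≤ n + b := by
      rw [hx.1 n, ← hk]
      have h1 : (b : ℝ) * (B - 1) ≤ (1 - Ω) * n := by
        calc (b : ℝ) * (B - 1) ≤ 2 * α * (Ω * n) * (B - 1) := by
              refine mul_le_mul_of_nonneg_right (hbk.trans ?_) (by linarith)
              exact mul_le_mul_of_nonneg_left hkΩ (by linarith)
          _ = 2 * α * Ω * (B - 1) * n := by ring
          _ ≤ _ := mul_le_mul_of_nonneg_right hBΩ (Nat.cast_nonneg n)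
      have h2 : (b : ℝ) * B + k ≤ n + b := by linarith
      exact_mod_cast h2
    obtain ⟨z, w, pos, hz, hw, hwG, hcz, hS⟩ := exists_blockVec (x n) G
      (hGsub.trans (Finset.filter_subset _ _)) hGcard hroom
    rw [hx.1 n, ← hk] at hcz
    have hexp := half_exponent_le (lam := lam) hz hw hcz (by omega : 0 < B)
      (fun T hT => card_distortion_le hz hw (u := u) (α := α) (by rw [hu]; ring) hu1 hb0
        (by rw [← hcz]; linarith) T (hT.trans hcz)) hlam0
      (fun j => by
        obtain ⟨i, hi, hwi⟩ := hwG j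
        rw [hwi, ← sq_abs]
        exact (pow_le_pow_left₀ (abs_nonneg _) (Finset.mem_filter.1 (hGsub hi)).2 2).trans hlam)
      hkn (Q n) (hQ n) (est n) (fun S => hn _ (hS S).1 (hS S).2)
    have hm : ((⌈ρ * (n : ℝ≥0)⌉₊ : ℕ) : ℝ) ≤ ρ * n + 1 := by
      have := (Nat.ceil_lt_add_one (show 0 ≤ ρ * (n : ℝ≥0) from zero_le)).le
      exact_mod_cast this
    have hm' := mul_le_mul_of_nonneg_right hm hlogl
    -- The two floors give `b > 2α(Ωn - 1) - 1`, and `2α ≤ 1`.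
    have hbD : (2 * α * Ω * n - 2) / 2 * D ≤ b / 2 * D := by
      refine mul_le_mul_of_nonneg_right ?_ hD0
      nlinarith
    rw [← hD] at hexp
    nlinarith
  by_contra hlt
  rw [not_le] at hlt
  have ht : Tendsto (fun n : ℕ => (α * Ω * D - ρ * Real.log (1 + lam)) * (n : ℝ)) atTop atTop :=
    tendsto_natCast_atTop_atTop.const_mul_atTop (sub_pos.2 hlt)
  obtain ⟨n, hn1, hn2⟩ := (hmain.and (ht.eventually_gt_atTop
    (D + Real.log u / 2 + Real.log (1 + lam) + 2))).exists
  exact absurd hn1 (not_le.2 hn2)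

/-! ### The distribution of the nonzero elements -/

section Distribution

variable {μ : Measure ℝ}

lemma real_Ioc_neg_eq [IsProbabilityMeasure μ] {t : ℝ} (ht : 0 ≤ t) :
    μ.real (Set.Ioc (-t) t) = cdf μ t - cdf μ (-t) := by
  rw [cdf_eq_real, cdf_eq_real, ← Set.Iic_sdiff_Iic, measureReal_sdiff
    (Set.Iic_subset_Iic.2 (by linarith)) measurableSet_Iic]

lemma exists_abs_mass_ge [IsProbabilityMeasure μ] {c : ℝ} (hc : c < 1) :
    ∃ t : ℝ, 0 ≤ t ∧ c ≤ μ.real {y : ℝ | |y| ≤ t} := by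
  have h : Tendsto (fun t : ℝ => cdf μ t - cdf μ (-t)) atTop (𝓝 (1 - 0)) :=
    (tendsto_cdf_atTop μ).sub ((tendsto_cdf_atBot μ).comp tendsto_neg_atTop_atBot)
  rw [sub_zero] at h
  obtain ⟨t, ht, ht0⟩ := ((h.eventually (eventually_gt_nhds hc)).and
    (eventually_ge_atTop 0)).exists
  refine ⟨t, ht0, ht.le.trans ?_⟩
  rw [← real_Ioc_neg_eq ht0]
  exact measureReal_mono fun y hy => abs_le.2 ⟨hy.1.le, hy.2⟩

/-- The quantiles of `|X|` away from `1` are bounded by a multiple of `ε ^ L`, if they are so for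
small `ε`. -/
lemma exists_quantile_bound [IsProbabilityMeasure μ] {L : ℝ}
    (hq : (fun ε : ℝ => absQuantile μ ε) =O[𝓝[>] 0] (fun ε : ℝ => ε ^ L)) :
    ∃ K : ℝ, 0 < K ∧ ∀ ε : ℝ, 0 < ε → ε < 3 / 4 →
      ∃ t : ℝ, 0 ≤ t ∧ t < K * ε ^ L ∧ ε ≤ μ.real {y : ℝ | |y| ≤ t} := by
  obtain ⟨c, hc0, hc⟩ := hq.exists_pos
  obtain ⟨δ, hδ, hδc⟩ := mem_nhdsGT_iff_exists_Ioo_subset.1 hc.bound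
  obtain ⟨T, hT0, hT⟩ := exists_abs_mass_ge (μ := μ) (c := 3 / 4) (by norm_num)
  have hδ0 : (0 : ℝ) < δ := hδ
  -- A positive lower bound for `ε ^ L` on `δ ≤ ε < 3 / 4`, whatever the sign of `L`; there a fixed
  -- `T` of mass at least `3 / 4` serves all `ε`.
  set q := min (δ ^ L) 1 with hq'
  have hq0 : 0 < q := lt_min (Real.rpow_pos_of_pos hδ0 L) one_pos
  refine ⟨c + 1 + T / q, by positivity, fun ε hε hε1 => ?_⟩
  have hεL := Real.rpow_pos_of_pos hε L
  by_cases hεδ : ε < δ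
  · have hbound : absQuantile μ ε ≤ c * ε ^ L := by
      have := hδc ⟨hε, hεδ⟩
      simp only [Set.mem_ofPred_eq, Real.norm_of_nonneg hεL.le] at this
      exact (le_abs_self _).trans this
    have hlt : absQuantile μ ε < (c + 1 + T / q) * ε ^ L := by
      have : 0 ≤ T / q * ε ^ L := by positivity
      linarith
    have hne : {x : ℝ | 0 ≤ x ∧ ε ≤ μ.real {y : ℝ | |y| ≤ x}}.Nonempty :=
      ⟨T, hT0, hε1.le.trans hT⟩
    obtain ⟨t, ⟨ht0, ht⟩, htlt⟩ := exists_lt_of_csInf_lt hne hlt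
    exact ⟨t, ht0, htlt, ht⟩
  · refine ⟨T, hT0, ?_, hε1.le.trans hT⟩
    have hge : q ≤ ε ^ L := by
      rcases le_total 0 L with hL | hL
      · exact (min_le_left _ _).trans
          (Real.rpow_le_rpow hδ0.le (not_lt.1 hεδ) hL)
      · exact (min_le_right _ _).trans
          (Real.one_le_rpow_of_pos_of_le_one_of_nonpos hε (by linarith) hL)
    have h1 : T ≤ T / q * ε ^ L := by
      calc T = T / q * q := by field_simp
        _ ≤ _ := mul_le_mul_of_nonneg_left hge (by positivity)
    have : 0 < (c + 1) * ε ^ L := by positivity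
    linarith

lemma mean_sq_add_variance_pos (hμ : IsAdmissible μ) :
    0 < (∫ x, x ∂μ) ^ 2 + Var[fun x : ℝ => x; μ] := by
  have := hμ.isProbabilityMeasure
  rw [variance_eq_sub hμ.memLp_two]
  simp only [Pi.pow_apply, add_sub_cancel]
  refine lt_of_le_of_ne (integral_nonneg fun x => sq_nonneg x) fun h => ?_
  have h0 := (integral_eq_zero_iff_of_nonneg (fun x : ℝ => sq_nonneg x)
    hμ.memLp_two.integrable_sq).1 h.symm
  have h1 : ∀ᵐ x ∂μ, x ∈ ({0} : Set ℝ) := h0.mono fun x hx => by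
    simpa using hx
  have h2 : μ ({0} : Set ℝ) = 1 :=
    (prob_compl_eq_zero_iff (measurableSet_singleton 0)).1 (mem_ae_iff.1 h1)
  rw [hμ.no_atom_zero] at h2
  exact zero_ne_one h2

lemma map_const_mul_singleton_zero (hμ : μ {0} = 0) {a : ℝ} (ha : 0 < a) :
    μ.map (fun x : ℝ => a * x) {0} = 0 := by
  rw [Measure.map_apply (by fun_prop) (measurableSet_singleton 0)]
  convert hμ using 2
  ext x
  simp [ha.ne']

/-- The strict inequality `t < τ` is needed because the difference of distribution functions omits
the left endpoint `-(a * τ)`. -/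
lemma le_cdf_map_const_mul_sub [IsProbabilityMeasure μ] {a t τ : ℝ} (ha : 0 < a)
    (ht : 0 ≤ t) (htτ : t < τ) :
    μ.real {y : ℝ | |y| ≤ t} ≤ cdf (μ.map (fun x : ℝ => a * x)) (a * τ) -
      cdf (μ.map (fun x : ℝ => a * x)) (-(a * τ)) := by
  have : IsProbabilityMeasure (μ.map (fun x : ℝ => a * x)) :=
    Measure.isProbabilityMeasure_map (by fun_prop)
  rw [← real_Ioc_neg_eq (by have := ht.trans_lt htτ; positivity),
    map_measureReal_apply (by fun_prop) measurableSet_Ioc]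
  refine measureReal_mono fun y hy => ?_
  have hy' : |y| ≤ t := hy
  obtain ⟨h1, h2⟩ := abs_le.1 hy'
  constructor
  · nlinarith
  · nlinarith

end Distribution

/-! ### Elementary inequalities -/

/-- Bernoulli's inequality with exponent `max 1 C`. It moves the constant out of the logarithm. -/
lemma log_one_add_mul_le {C y : ℝ} (hC : 0 ≤ C) (hy : 0 ≤ y) :
    Real.log (1 + C * y) ≤ max 1 C * Real.log (1 + y) := by
  rw [← Real.log_rpow (by linarith)]
  refine Real.log_le_log (by positivity) ?_
  calc 1 + C * y ≤ 1 + max 1 C * y := by gcongr; exact le_max_right _ _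
    _ ≤ _ := one_add_mul_self_le_rpow_one_add (by linarith) (le_max_left _ _)

/-- The right-hand side vanishes at `u = 1`, so `u` must stay away from `1`. A first-order lower
bound for `log u` based at `3 / 2` leaves enough slack to absorb `log 8` and the factor `1 / 100`.
-/
lemma log_le_mul_exponent {r u : ℝ} (hr : 0 < r) (hu : 3 / 2 ≤ u) (hru : r ≤ 8 * u) :
    Real.log r / 100 ≤ Real.log u - 1 + 1 / u := by
  have hu0 : 0 < u := by linarith
  have h1 : Real.log r ≤ 3 * Real.log 2 + Real.log u := by
    calc Real.log r ≤ Real.log (2 ^ 3 * u) := Real.log_le_log hr (by linarith)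
      _ = _ := by rw [Real.log_mul (by norm_num) hu0.ne', Real.log_pow]; norm_num
  have h2 := Real.log_two_lt_d9
  have h3 : 2 / 5 ≤ Real.log (3 / 2) := by
    have := Real.le_log_one_add_of_nonneg (x := 1 / 2) (by norm_num)
    norm_num at this ⊢
    exact this
  have h4 : Real.log (3 / 2) + (1 - 3 / 2 * (1 / u)) ≤ Real.log u := by
    have := Real.one_sub_inv_le_log_of_pos (show 0 < u / (3 / 2) by positivity)
    rw [Real.log_div hu0.ne' (by norm_num), inv_div, div_eq_mul_one_div] at this
    linarith
  have h5 : 1 / u ≤ 2 / 3 := by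
    rw [div_le_div_iff₀ hu0 (by norm_num)]; linarith
  linarith

end SparsityPattern

/-! ### Choice of the parameters -/

open SparsityPattern in
theorem proposition7 (μ : MeasureTheory.Measure ℝ) (hμ : SparsityPattern.IsAdmissible μ)
    (L : ℝ) (hL : SparsityPattern.HasDecayRate μ L)
    (hq : (fun ε : ℝ => SparsityPattern.absQuantile μ ε) =O[𝓝[>] 0] (fun ε : ℝ => ε ^ L)) :
    ∃ C : ℝ, 0 < C ∧
      ∀ Ω : ℝ, 0 < Ω → Ω ≤ 1 / 2 → ∀ P : ℝ, 0 < P → ∀ α : ℝ, 0 < α → α < 1 / 4 →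
        ENNReal.ofReal
            (C * (α * Ω * Real.log (1 / (α * Ω)) / Real.log (1 + α ^ (2 * L + 1) * P)))
          ≤ SparsityPattern.rateDistortion
              (SparsityPattern.source Ω (SparsityPattern.rescale Ω P μ)) α := by
  have := hμ.isProbabilityMeasure
  obtain ⟨K, hK0, hK⟩ := exists_quantile_bound hq
  set M := (∫ x, x ∂μ) ^ 2 + Var[fun x : ℝ => x; μ] with hM
  have hM0 : 0 < M := mean_sq_add_variance_pos hμ
  -- Chosen so that `C₁ * y` equals `4αΩ (a τ) ^ 2`, which dominates `(a τ) ^ 2 / B` since `1 ≤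
  -- 4αΩB`.
  set C₁ : ℝ := 4 * (K * 3 ^ L) ^ 2 / M with hC₁
  have hC₁0 : 0 ≤ C₁ := by positivity
  refine ⟨1 / (100 * max 1 C₁), by positivity, fun Ω hΩ hΩ1 P hP α hα hα1 => ?_⟩
  refine le_iInf₂ fun ρ hρ => ENNReal.ofReal_le_of_le_toReal ?_
  rw [ENNReal.coe_toReal]
  set a := √(P / power Ω μ) with ha
  have hpow : power Ω μ = Ω * M := rfl
  have ha0 : 0 < a := Real.sqrt_pos.2 (by rw [hpow]; positivity)
  have ha2 : a ^ 2 = P / (Ω * M) := by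
    rw [ha, Real.sq_sqrt (by rw [hpow]; positivity), hpow]
  -- The condition `α < 1 / 4` puts the level `3α` below `3 / 4`, within the range of the quantile
  -- bound.
  obtain ⟨t, ht0, htτ, ht⟩ := hK (3 * α) (by linarith) (by linarith)
  set τ := K * (3 * α) ^ L with hτ
  set y := α ^ (2 * L + 1) * P with hy
  have hy0 : 0 < y := by positivity
  have hαΩ : 0 < α * Ω := by positivity
  have hαΩ1 : α * Ω ≤ 1 / 8 := by nlinarith
  -- The largest block size for which `b` blocks still fit, from `2αΩ (B - 1) ≤ 1 - Ω`. The ranges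
  -- of `α` and `Ω` ensure `B ≥ 3`, which keeps `B / 2` away from `1`.
  set B := ⌊1 + (1 - Ω) / (2 * α * Ω)⌋₊ with hB
  have hBpos : 0 < 2 * α * Ω := by positivity
  have hBle : (B : ℝ) ≤ 1 + (1 - Ω) / (2 * α * Ω) := Nat.floor_le (by
    have : 0 ≤ (1 - Ω) / (2 * α * Ω) := div_nonneg (by linarith) hBpos.le
    linarith)
  have hBlt : 1 + (1 - Ω) / (2 * α * Ω) < B + 1 := Nat.lt_floor_add_one _
  have hB3 : 3 ≤ B := by
    refine Nat.le_floor ?_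
    have : 2 ≤ (1 - Ω) / (2 * α * Ω) := by
      rw [le_div_iff₀ hBpos]; nlinarith
    push_cast
    linarith
  have hB3' : (3 : ℝ) ≤ B := by exact_mod_cast hB3
  have hBαΩ : 1 ≤ 4 * (α * Ω) * B := by
    have h1 : (1 - Ω) / (2 * α * Ω) < B := by linarith
    rw [div_lt_iff₀ hBpos] at h1
    nlinarith
  have hτ2 : (a * τ) ^ 2 * (4 * (α * Ω)) = C₁ * y := by
    have h3 : (3 * α) ^ L = 3 ^ L * α ^ L := Real.mul_rpow (by norm_num) hα.le
    have h4 : α ^ (2 * L + 1) = (α ^ L) ^ 2 * α := by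
      rw [Real.rpow_add hα, Real.rpow_one, mul_comm 2 L, Real.rpow_mul hα.le, Real.rpow_two]
    rw [mul_pow, ha2, hτ, hy, hC₁, h3, h4]
    field_simp
  have hprob : IsProbabilityMeasure (rescale Ω P μ) :=
    Measure.isProbabilityMeasure_map (by fun_prop)
  have hconv := converse_of_achievable (τ := a * τ) (lam := C₁ * y) (B := B) (rescale Ω P μ)
    (map_const_mul_singleton_zero hμ.no_atom_zero ha0) hΩ (by linarith) hα (by linarith)
    (by omega)
    (by
      have : (B : ℝ) - 1 ≤ (1 - Ω) / (2 * α * Ω) := by linarith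
      rw [le_div_iff₀ hBpos] at this
      linarith)
    (ht.trans (le_cdf_map_const_mul_sub ha0 ht0 htτ)) (by positivity)
    (by
      rw [← hτ2]
      nlinarith [mul_le_mul_of_nonneg_left hBαΩ (sq_nonneg (a * τ))])
    hρ
  have hexp := log_le_mul_exponent (r := 1 / (α * Ω)) (u := B / 2) (by positivity)
    (by linarith) (by rw [div_le_iff₀ hαΩ]; linarith)
  have hlog := log_one_add_mul_le hC₁0 hy0.le
  have hlogy : 0 < Real.log (1 + y) := Real.log_pos (by linarith)
  have h1 := mul_le_mul_of_nonneg_left hexp hαΩ.le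
  have h2 := mul_le_mul_of_nonneg_left hlog ρ.2
  have hmax : 0 < max 1 C₁ := lt_of_lt_of_le one_pos (le_max_left _ _)
  rw [← mul_div_assoc, div_le_iff₀ hlogy, one_div, inv_mul_le_iff₀ (by positivity)]
  have h3 : α * Ω * (Real.log (1 / (α * Ω)) / 100) ≤ ρ * (max 1 C₁ * Real.log (1 + y)) :=
    h1.trans (hconv.trans h2)
  linarith
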